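/- Let $n\ge 3$ and let $B_n$ be the $n$-string braid group in the band generator (``new'') presentation: generators $a_{ts}$ for $n\ge t>s\ge 1$, with relations $a_{ts}a_{rq}=a_{rq}a_{ts}$ whenever $(t-r)(t-q)(s-r)(s-q)>0$, and $a_{ts}a_{sr}=a_{tr}a_{ts}=a_{sr}a_{tr}$ for $n\ge t>s>r\ge 1$. Write $[t,t-1,\ldots,s]=a_{t(t-1)}a_{(t-1)(t-2)}\cdots a_{(s+1)s}$ (the trivial braid $e$ if $t=s$), let $\delta=[n,n-1,\ldots,1]$, let $B_n^+$ be the monoid of positive braids, and let $\tau$ be the automorphism of $B_n$ with $\tau(a_{ts})=a_{(t+1)(s+1)}$ (indices modulo $n$, with $a_{st}=a_{ts}$). Write $V\le W$ if $W=VP$ with $P\in B_n^+$. Let $Q$ be the set of $A\in B_n^+$ with $A\le\delta$, and $Q^\star=Q\setminus\{e,\delta\}$. A product $AP$ with $A\in Q$, $P\in B_n^+$ is left-greedy if $A'\le A$ whenever $AP=A'P'$ with $A'\in Q$, $P'\in B_n^+$. Every $W\in B_n$ has a unique normal form $W=\delta^uA_1A_2\cdots A_k$ with $u\in\mathbb Z$,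 $A_i\in Q^\star$ and every $A_iA_{i+1}$ left-greedy; put $\inf(W)=u$, and define the cycling of $W$ by $\mathbf c(W)=\delta^uA_2\cdots A_k\,\tau^{-u}(A_1)$ (and $\mathbf c(W)=W$ if $k=0$). Let $W=[2,1]\,[n,n-1,\ldots,3,2]$. Then $W=\bigl([2,1][n,n-1,\ldots,3]\bigr)\bigl([3,2]\bigr)$ is the normal form of $W$ (with $u=0$ and $k=2$), and $$\inf(W)=\inf(\mathbf c(W))=\cdots=\inf(\mathbf c^{n-3}(W))=0,\qquad \inf(\mathbf c^{n-2}(W))=1.$$ Consequently the bound $n-2$ on the number of cyclings needed to increase a non-maximal infimum is sharp, in the sense that it cannot be lowered: if $m\ge 0$ is an integer such that $\inf(\mathbf c^{m}(X))>\inf(X)$ for every $X\in B_n$ whose infimum is not maximal in its conjugacy class, then $m\ge n-2$. -/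

import Mathlib

namespace BandBraid

/-- Indices of the band generators `a_{ts}`, `n ≥ t > s ≥ 1`; the pair is `(t, s)`. -/
abbrev Gen (n : ℕ) : Type := {p : ℕ × ℕ // 1 ≤ p.2 ∧ p.2 < p.1 ∧ p.1 ≤ n}

/-- The condition `(t - r)(t - q)(s - r)(s - q) > 0` on the pairs `(t, s)` and `(r, q)`. -/
def Unlinked (p q : ℕ × ℕ) : Prop :=
  0 < ((p.1 : ℤ) - q.1) * ((p.1 : ℤ) - q.2) * ((p.2 : ℤ) - q.1) * ((p.2 : ℤ) - q.2)

/-- The three pairs are `(t, s)`, `(s, r)`, `(t, r)` for some `t, s, r`. -/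
def IsTriple (x y z : ℕ × ℕ) : Prop :=
  x.1 = z.1 ∧ x.2 = y.1 ∧ y.2 = z.2

/-- The relators of the band generator presentation:
`a_{ts} a_{rq} = a_{rq} a_{ts}` if `(t - r)(t - q)(s - r)(s - q) > 0`, and
`a_{ts} a_{sr} = a_{tr} a_{ts} = a_{sr} a_{tr}` if `t > s > r`. -/
inductive Relator (n : ℕ) : FreeGroup (Gen n) → Prop
  | comm (x y : Gen n) (h : Unlinked x.1 y.1) :
      Relator n (FreeGroup.of x * FreeGroup.of y * (FreeGroup.of y * FreeGroup.of x)⁻¹)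
  | tripleLeft (x y z : Gen n) (h : IsTriple x.1 y.1 z.1) :
      Relator n (FreeGroup.of x * FreeGroup.of y * (FreeGroup.of z * FreeGroup.of x)⁻¹)
  | tripleRight (x y z : Gen n) (h : IsTriple x.1 y.1 z.1) :
      Relator n (FreeGroup.of z * FreeGroup.of x * (FreeGroup.of y * FreeGroup.of z)⁻¹)

/-- The braid group `B_n`, given by the band generator ("new") presentation. -/
abbrev Braid (n : ℕ) : Type := PresentedGroup {w : FreeGroup (Gen n) | Relator n w}

/-- The class in `B_n` of a band generator. -/
def gen {n : ℕ} (x : Gen n) : Braid n := PresentedGroup.of x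

/-- The generator `a_{ts}` of `B_n` for `n ≥ t > s ≥ 1` (and `1` for other indices, a value that
is never used). -/
def a (n t s : ℕ) : Braid n :=
  if h : 1 ≤ s ∧ s < t ∧ t ≤ n then gen ⟨(t, s), h⟩ else 1

/-- The descending product `[t, t-1, …, s] = a_{t(t-1)} a_{(t-1)(t-2)} ⋯ a_{(s+1)s}`, which is
the trivial braid if `t = s`. -/
def desc (n : ℕ) : ℕ → ℕ → Braid n
  | 0, _ => 1
  | t + 1, s => if s ≤ t then a n (t + 1) t * desc n t s else 1

/-- The fundamental braid `δ = a_{n(n-1)} ⋯ a_{32} a_{21} = [n, n-1, …, 1]`. -/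
def delta (n : ℕ) : Braid n := desc n n 1

/-- The positive braids `B_n^+`, as a submonoid of `B_n`. -/
def Pos (n : ℕ) : Submonoid (Braid n) := Submonoid.closure (Set.range gen)

/-- `V ≤ W`, that is, `W = V P` for some positive `P`. -/
def Le {n : ℕ} (V W : Braid n) : Prop := ∃ P ∈ Pos n, W = V * P

/-- The set `Q` of the initial subwords of `δ`: positive `A` with `δ = A B`, `B` positive. -/
def Q (n : ℕ) : Set (Braid n) := {A | A ∈ Pos n ∧ Le A (delta n)}

/-- `Q* = Q \ {e, δ}`. -/
def QStar (n : ℕ) : Set (Braid n) := Q n \ {1, delta n}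

/-- `A P` is a left-greedy decomposition: `A ∈ Q`, `P` is positive, and `A' ≤ A` for every
decomposition `A P = A' P'` with `A' ∈ Q` and `P'` positive. -/
def LeftGreedy {n : ℕ} (A P : Braid n) : Prop :=
  A ∈ Q n ∧ P ∈ Pos n ∧ ∀ A' ∈ Q n, ∀ P' ∈ Pos n, A * P = A' * P' → Le A' A

/-- `W = δ^u A_1 A_2 ⋯ A_k` is in normal form, with `L = [A_1, …, A_k]`. -/
def IsNormalForm {n : ℕ} (W : Braid n) (u : ℤ) (L : List (Braid n)) : Prop :=
  W = delta n ^ u * L.prod ∧ (∀ A ∈ L, A ∈ QStar n) ∧ L.IsChain LeftGreedy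

/-- The rotation `a_{ts} ↦ a_{(t+1)(s+1)}` of the generators, with indices modulo `n` and
`a_{1(s+1)}` read as `a_{(s+1)1}`. -/
def rot (n : ℕ) : Gen n ≃ Gen n where
  toFun x := if h : x.1.1 = n then ⟨(x.1.2 + 1, 1), by have := x.2; dsimp only; omega⟩
    else ⟨(x.1.1 + 1, x.1.2 + 1), by have := x.2; dsimp only; omega⟩
  invFun x := if h : x.1.2 = 1 then ⟨(n, x.1.1 - 1), by have := x.2; dsimp only; omega⟩
    else ⟨(x.1.1 - 1, x.1.2 - 1), by have := x.2; dsimp only; omega⟩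
  left_inv x := by
    obtain ⟨⟨t, s⟩, h1, h2, h3⟩ := x
    dsimp only at h1 h2 h3
    by_cases h : t = n
    · subst h; simp
    · have : s ≠ 0 := by omega
      simp [h, this]
  right_inv x := by
    obtain ⟨⟨t, s⟩, h1, h2, h3⟩ := x
    dsimp only at h1 h2 h3
    by_cases h : s = 1
    · subst h
      have : t - 1 + 1 = t := by omega
      simp [this]
    · have h4 : t - 1 ≠ n := by omega
      have h5 : t - 1 + 1 = t := by omega
      have h6 : s - 1 + 1 = s := by omega
      simp [h, h4, h5, h6]

theorem rot_val {n : ℕ} (x : Gen n) :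
    (rot n x).1 = if x.1.1 = n then (x.1.2 + 1, 1) else (x.1.1 + 1, x.1.2 + 1) := by
  simp only [rot, Equiv.coe_fn_mk]
  split_ifs <;> rfl

theorem gen_comm {n : ℕ} (x y : Gen n) (h : Unlinked x.1 y.1) :
    gen x * gen y = gen y * gen x :=
  mul_inv_eq_one.mp (PresentedGroup.one_of_mem (Relator.comm x y h))

theorem gen_tripleLeft {n : ℕ} (x y z : Gen n) (h : IsTriple x.1 y.1 z.1) :
    gen x * gen y = gen z * gen x :=
  mul_inv_eq_one.mp (PresentedGroup.one_of_mem (Relator.tripleLeft x y z h))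

theorem gen_tripleRight {n : ℕ} (x y z : Gen n) (h : IsTriple x.1 y.1 z.1) :
    gen z * gen x = gen y * gen z :=
  mul_inv_eq_one.mp (PresentedGroup.one_of_mem (Relator.tripleRight x y z h))

theorem unlinked_rot {n : ℕ} (x y : Gen n) (h : Unlinked x.1 y.1) :
    Unlinked (rot n x).1 (rot n y).1 := by
  obtain ⟨⟨t, s⟩, h1, h2, h3⟩ := x
  obtain ⟨⟨r, q⟩, h4, h5, h6⟩ := y
  rw [rot_val, rot_val]
  simp only [Unlinked] at *
  split_ifs with c d d
  · subst c; subst d; simp at h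
  · subst c
    push_cast
    have e1 : (0 : ℤ) < (t : ℤ) - r := by omega
    have e2 : (0 : ℤ) < (t : ℤ) - q := by omega
    have e3 : (0 : ℤ) < r := by omega
    have e4 : (0 : ℤ) < q := by omega
    rw [mul_assoc] at h
    have := pos_of_mul_pos_right h (by positivity)
    have := mul_pos this (mul_pos e3 e4)
    linarith
  · subst d
    push_cast
    have e1 : (0 : ℤ) < (r : ℤ) - t := by omega
    have e2 : (0 : ℤ) < (r : ℤ) - s := by omega
    have e3 : (0 : ℤ) < t := by omega
    have e4 : (0 : ℤ) < s := by omega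
    have h' : 0 < (((r : ℤ) - t) * ((r : ℤ) - s)) * (((t : ℤ) - q) * ((s : ℤ) - q)) := by
      linarith
    have := pos_of_mul_pos_right h' (by positivity)
    have := mul_pos this (mul_pos e3 e4)
    linarith
  · push_cast
    simpa using h

theorem triple_rot {n : ℕ} (x y z : Gen n) (h : IsTriple x.1 y.1 z.1) :
    IsTriple (rot n x).1 (rot n y).1 (rot n z).1 ∨
      IsTriple (rot n y).1 (rot n z).1 (rot n x).1 := by
  obtain ⟨⟨t, s⟩, h1, h2, h3⟩ := x
  obtain ⟨⟨s', r⟩, h4, h5, h6⟩ := y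
  obtain ⟨⟨t', r'⟩, h7, h8, h9⟩ := z
  obtain ⟨rfl, rfl, rfl⟩ := h
  dsimp only at h2
  rw [rot_val, rot_val, rot_val]
  simp only [IsTriple]
  have : s ≠ n := by omega
  by_cases c : t = n <;> simp [c, this]

/-- The index shift as a homomorphism. -/
def tauHom (n : ℕ) : Monoid.End (Braid n) :=
  PresentedGroup.toGroup (f := fun x => gen (rot n x)) (by
    rintro _ (⟨x, y, h⟩ | ⟨x, y, z, h⟩ | ⟨x, y, z, h⟩)
    · simp only [map_mul, map_inv, FreeGroup.lift_apply_of]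
      exact mul_inv_eq_one.mpr (gen_comm _ _ (unlinked_rot x y h))
    · simp only [map_mul, map_inv, FreeGroup.lift_apply_of]
      refine mul_inv_eq_one.mpr ?_
      rcases triple_rot x y z h with h' | h'
      · exact gen_tripleLeft _ _ _ h'
      · exact gen_tripleRight _ _ _ h'
    · simp only [map_mul, map_inv, FreeGroup.lift_apply_of]
      refine mul_inv_eq_one.mpr ?_
      rcases triple_rot x y z h with h' | h'
      · exact gen_tripleRight _ _ _ h'
      · exact ((gen_tripleLeft _ _ _ h').trans (gen_tripleRight _ _ _ h')).symm)

theorem tauHom_gen {n : ℕ} (x : Gen n) : tauHom n (gen x) = gen (rot n x) :=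
  PresentedGroup.toGroup.of _

theorem tauHom_pow_gen {n : ℕ} (k : ℕ) (x : Gen n) :
    (tauHom n ^ k) (gen x) = gen (((rot n : Equiv.Perm (Gen n)) ^ k) x) := by
  induction k generalizing x with
  | zero => rfl
  | succ k ih =>
    rw [pow_succ, pow_succ]
    exact (congrArg _ (tauHom_gen x)).trans (ih _)

instance (n : ℕ) : Finite (Gen n) :=
  Finite.of_injective
    (fun x : Gen n => ((⟨x.1.1, by have := x.2; omega⟩, ⟨x.1.2, by have := x.2; omega⟩) :
      Fin (n + 1) × Fin (n + 1)))
    (fun x y h => by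
      simp only [Prod.mk.injEq, Fin.mk.injEq] at h
      exact Subtype.ext (Prod.ext h.1 h.2))

theorem tauHom_pow_orderOf (n : ℕ) :
    tauHom n ^ orderOf (rot n : Equiv.Perm (Gen n)) = 1 := by
  refine PresentedGroup.ext fun x => ?_
  refine (tauHom_pow_gen _ x).trans ?_
  rw [pow_orderOf_eq_one]
  rfl

theorem tauHom_bijective (n : ℕ) : Function.Bijective (tauHom n) := by
  have hpos : 0 < orderOf (rot n : Equiv.Perm (Gen n)) := orderOf_pos _
  obtain ⟨k, hk⟩ : ∃ k, orderOf (rot n : Equiv.Perm (Gen n)) = k + 1 :=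
    ⟨_, (Nat.succ_pred_eq_of_pos hpos).symm⟩
  have h := tauHom_pow_orderOf n
  rw [hk] at h
  refine ⟨Function.LeftInverse.injective
    (g := (tauHom n ^ k : Monoid.End (Braid n))) fun x => ?_,
    Function.RightInverse.surjective
    (g := (tauHom n ^ k : Monoid.End (Braid n))) fun x => ?_⟩
  · rw [pow_succ] at h
    exact DFunLike.congr_fun h x
  · rw [pow_succ'] at h
    exact DFunLike.congr_fun h x

/-- The index-shift automorphism `τ` of `B_n`, with `τ(a_{ts}) = a_{(t+1)(s+1)}`. -/
noncomputable def tau (n : ℕ) : MulAut (Braid n) :=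
  MulEquiv.ofBijective (tauHom n) (tauHom_bijective n)

/-- The braid `δ^u A_2 A_3 ⋯ A_k τ^{-u}(A_1)` obtained from `δ^u A_1 A_2 ⋯ A_k`; if `k = 0`,
nothing changes. -/
noncomputable def cycleForm {n : ℕ} (u : ℤ) : List (Braid n) → Braid n
  | [] => delta n ^ u
  | A :: L => delta n ^ u * L.prod * (tau n ^ (-u)) A

/-- The infimum `inf(W)`: the exponent `u` of the normal form of `W`. -/
noncomputable def inf {n : ℕ} (W : Braid n) : ℤ :=
  Classical.epsilon fun u => ∃ L, IsNormalForm W u L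

/-- The cycling `c(W)`, computed from the normal form of `W`. -/
noncomputable def cycling {n : ℕ} (W : Braid n) : Braid n :=
  Classical.epsilon fun V => ∃ u L, IsNormalForm W u L ∧ V = cycleForm u L

end BandBraid

/-! Put $W_m=[m,\ldots,1][n,\ldots,m]$, so that $W=W_2$ and $W_n=\delta$. For $2\le m<n$ write
$W_m=AB$ with $A=[m,\ldots,1][n,\ldots,m+1]$ and $B=a_{(m+1)m}$. Since $\delta=A\,a_{(m+1)1}$, the
complement of $A$ in $\delta$ is a single atom, and $AB$ is left-greedy unless $AB=\delta$.
Permutations exclude that: $W_m$ sends $1$ to $m$, while $\delta$ sends $1$ to $n$. So $A\cdot B$ is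
a normal form of infimum $0$, and cycling, untwisted because $u=0$, gives $BA=W_{m+1}$. Each cycling
raises $m$ by one, and $\delta$, of infimum $1$, is reached after exactly $n-2$ of them. As $W$ is
conjugate to $\delta$, its infimum is not maximal, which gives sharpness.

The weight of the proof lies elsewhere. `inf` and `cycling` are read off some normal form, so they
can be evaluated only once normal forms are unique (`IsNormalForm.unique`); existence is needed only
for the braids above. Uniqueness is Garside theory of the dual braid monoid. Its simple elements are
modelled by the permutations below the Coxeter element in the absolute order, with length the
codimension of the fixed space. Comparing fixed spaces (`codimFix_add_of_fixSpace_le`) reduces this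
order to functions constant on cycles. A connectivity property of atoms (`eq_of_joinable`) then
yields both the existence of meets and the independence of a simple braid from its reduced word.

Simple elements act on greedy sequences by left multiplication with carries. This is only a monoid
action, but a power of the top element acts centrally and injectively; inverting it makes all
generators units, so positive words equal in the group $B_n$ act equally (`actWord_eq_of_word_eq`).
Applied to the trivial sequence, a normal form reproduces its own factors, hence is unique. -/

namespace BandBraid

/-! ### Fixed spaces and the absolute order on the orthogonal group -/

section Orthogonal

open Module
open scoped RealInnerProductSpace

variable {E : Type*} [NormedAddCommGroup E] [InnerProductSpace ℝ E]

/-- The fixed space of a linear isometry. -/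
def fixSpace (g : E ≃ₗᵢ[ℝ] E) : Submodule ℝ E :=
  LinearMap.ker ((g.toLinearEquiv : E →ₗ[ℝ] E) - LinearMap.id)

theorem mem_fixSpace {g : E ≃ₗᵢ[ℝ] E} {v : E} : v ∈ fixSpace g ↔ g v = v := by
  simp [fixSpace, sub_eq_zero]

theorem fixSpace_inv (g : E ≃ₗᵢ[ℝ] E) : fixSpace g⁻¹ = fixSpace g := by
  ext v
  rw [mem_fixSpace, mem_fixSpace]
  exact ⟨fun h => by conv_lhs => rw [← h]
                     exact g.apply_symm_apply v,
    fun h => by conv_lhs => rw [← h]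
                exact g.symm_apply_apply v⟩

theorem inf_fixSpace_le_mul (g h : E ≃ₗᵢ[ℝ] E) : fixSpace g ⊓ fixSpace h ≤ fixSpace (g * h) := by
  rintro v ⟨hg, hh⟩
  rw [SetLike.mem_coe, mem_fixSpace] at hg hh
  rw [mem_fixSpace, LinearIsometryEquiv.coe_mul, Function.comp_apply, hh, hg]

theorem inner_sub_of_mem_fixSpace {g : E ≃ₗᵢ[ℝ] E} {f : E} (hf : f ∈ fixSpace g) (v : E) :
    ⟪g v - v, f⟫ = 0 := by
  rw [mem_fixSpace] at hf
  rw [inner_sub_left, sub_eq_zero]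
  conv_lhs => rw [← hf]
  exact g.inner_map_map v f

theorem sub_mem_orthogonal_fixSpace (g : E ≃ₗᵢ[ℝ] E) (v : E) : g v - v ∈ (fixSpace g)ᗮ := by
  rw [Submodule.mem_orthogonal']
  exact fun f hf => inner_sub_of_mem_fixSpace hf v

variable [FiniteDimensional ℝ E]

/-- If $f$ is orthogonal to the range of $g-1$, then $\langle gf,f\rangle=|f|^2=|gf|^2$, which
forces $gf=f$. Taking orthogonal complements gives the claim. -/
theorem exists_sub_eq_of_mem_orthogonal {g : E ≃ₗᵢ[ℝ] E} {a : E} (ha : a ∈ (fixSpace g)ᗮ) :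
    ∃ v, g v - v = a := by
  set R := LinearMap.range ((g.toLinearEquiv : E →ₗ[ℝ] E) - LinearMap.id) with hR
  have hle : Rᗮ ≤ fixSpace g := by
    intro f hf
    have h1 : ∀ v, ⟪g v - v, f⟫ = 0 := fun v =>
      (Submodule.mem_orthogonal _ _).mp hf _ ⟨v, by simp⟩
    rw [mem_fixSpace, ← sub_eq_zero, ← inner_self_eq_zero (𝕜 := ℝ)]
    have h2 := h1 f
    have h3 : ⟪g f, g f⟫ = ⟪f, f⟫ := g.inner_map_map f f
    rw [inner_sub_left] at h2
    rw [inner_sub_left, inner_sub_right, inner_sub_right, h3, real_inner_comm (g f) f]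
    linarith
  have h4 := Submodule.orthogonal_le hle ha
  rw [Submodule.orthogonal_orthogonal] at h4
  obtain ⟨v, hv⟩ := h4
  exact ⟨v, by simpa using hv⟩

/-- The codimension of the fixed space of a linear isometry. -/
noncomputable def codimFix (g : E ≃ₗᵢ[ℝ] E) : ℕ := finrank ℝ (fixSpace g)ᗮ

theorem finrank_fixSpace_add_codimFix (g : E ≃ₗᵢ[ℝ] E) :
    finrank ℝ (fixSpace g) + codimFix g = finrank ℝ E :=
  Submodule.finrank_add_finrank_orthogonal _

theorem codimFix_mul_le (g h : E ≃ₗᵢ[ℝ] E) : codimFix (g * h) ≤ codimFix g + codimFix h := by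
  have h1 := Submodule.finrank_sup_add_finrank_inf_eq (fixSpace g) (fixSpace h)
  have h2 := Submodule.finrank_mono (inf_fixSpace_le_mul g h)
  have h3 := Submodule.finrank_le (fixSpace g ⊔ fixSpace h)
  have := finrank_fixSpace_add_codimFix g
  have := finrank_fixSpace_add_codimFix h
  have := finrank_fixSpace_add_codimFix (g * h)
  omega

theorem codimFix_conj (g h : E ≃ₗᵢ[ℝ] E) : codimFix (h * g * h⁻¹) = codimFix g := by
  have key : fixSpace (h * g * h⁻¹) = (fixSpace g).map (h.toLinearEquiv : E →ₗ[ℝ] E) := by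
    ext v
    rw [mem_fixSpace, Submodule.mem_map]
    constructor
    · intro hv
      refine ⟨h.symm v, ?_, by simp⟩
      rw [mem_fixSpace]
      apply h.injective
      rw [h.apply_symm_apply]
      exact hv
    · rintro ⟨w, hw, rfl⟩
      rw [mem_fixSpace] at hw
      change h (g (h.symm (h w))) = h w
      rw [h.symm_apply_apply, hw]
  have h1 := finrank_fixSpace_add_codimFix g
  have h2 := finrank_fixSpace_add_codimFix (h * g * h⁻¹)
  rw [key, LinearEquiv.finrank_map_eq] at h2
  omega

theorem codimFix_eq_zero {g : E ≃ₗᵢ[ℝ] E} (h : codimFix g = 0) : g = 1 := by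
  have h1 := finrank_fixSpace_add_codimFix g
  have h2 : fixSpace g = ⊤ := Submodule.eq_top_of_finrank_eq (by omega)
  ext v
  exact mem_fixSpace.mp (h2 ▸ Submodule.mem_top)

theorem codimFix_one : codimFix (1 : E ≃ₗᵢ[ℝ] E) = 0 := by
  have h1 := finrank_fixSpace_add_codimFix (1 : E ≃ₗᵢ[ℝ] E)
  have h2 : fixSpace (1 : E ≃ₗᵢ[ℝ] E) = ⊤ := by
    ext v
    simp [mem_fixSpace]
  rw [h2, finrank_top] at h1
  omega

section Factorization

variable {g h : E ≃ₗᵢ[ℝ] E} (hl : codimFix g + codimFix h = codimFix (g * h))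
include hl

/-- One inclusion always holds. The dimension of $\mathrm{Fix}\,g\cap\mathrm{Fix}\,h$ is at least
$\dim E$ minus both codimensions, which by additivity is already $\dim\mathrm{Fix}(gh)$. -/
theorem fixSpace_mul_eq : fixSpace (g * h) = fixSpace g ⊓ fixSpace h := by
  refine (Submodule.eq_of_le_of_finrank_le (inf_fixSpace_le_mul g h) ?_).symm
  have h1 := Submodule.finrank_sup_add_finrank_inf_eq (fixSpace g) (fixSpace h)
  have h3 := Submodule.finrank_le (fixSpace g ⊔ fixSpace h)
  have := finrank_fixSpace_add_codimFix g
  have := finrank_fixSpace_add_codimFix h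
  have := finrank_fixSpace_add_codimFix (g * h)
  omega

theorem fixSpace_sup_eq_top : fixSpace g ⊔ fixSpace h = ⊤ := by
  refine Submodule.eq_top_of_finrank_eq ?_
  have h1 := Submodule.finrank_sup_add_finrank_inf_eq (fixSpace g) (fixSpace h)
  rw [← fixSpace_mul_eq hl] at h1
  have := finrank_fixSpace_add_codimFix g
  have := finrank_fixSpace_add_codimFix h
  have := finrank_fixSpace_add_codimFix (g * h)
  omega

/-- The fixed space of the right factor is thus determined by the product and the fixed space of the
left factor. The point is that $hv-v$ lies in $(\mathrm{Fix}\,g)^\perp\cap(\mathrm{Fix}\,h)^\perp$,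
which vanishes because the two fixed spaces span. -/
theorem mem_fixSpace_right_iff (v : E) :
    v ∈ fixSpace h ↔ (g * h) v - v ∈ (fixSpace g)ᗮ := by
  constructor
  · intro hv
    rw [mem_fixSpace] at hv
    rw [LinearIsometryEquiv.coe_mul, Function.comp_apply, hv]
    exact sub_mem_orthogonal_fixSpace g v
  · intro hv
    have h1 : h v - v ∈ (fixSpace g)ᗮ := by
      have := Submodule.sub_mem _ hv (sub_mem_orthogonal_fixSpace g (h v))
      rw [LinearIsometryEquiv.coe_mul, Function.comp_apply] at this
      simpa using this
    have h2 : h v - v ∈ (fixSpace g ⊔ fixSpace h)ᗮ := by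
      rw [← Submodule.inf_orthogonal]
      exact ⟨h1, sub_mem_orthogonal_fixSpace h v⟩
    rw [fixSpace_sup_eq_top hl, Submodule.top_orthogonal_eq_bot, Submodule.mem_bot,
      sub_eq_zero] at h2
    exact mem_fixSpace.mpr h2

end Factorization

/-- Below a given isometry, the absolute order is reverse inclusion of fixed spaces. -/
theorem codimFix_add_of_fixSpace_le {c x y : E ≃ₗᵢ[ℝ] E}
    (hx : codimFix x + codimFix (x⁻¹ * c) = codimFix c)
    (hy : codimFix y + codimFix (y⁻¹ * c) = codimFix c) (hle : fixSpace y ≤ fixSpace x) :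
    codimFix x + codimFix (x⁻¹ * y) = codimFix y := by
  have ex : x * (x⁻¹ * c) = c := mul_inv_cancel_left x c
  have ey : y * (y⁻¹ * c) = c := mul_inv_cancel_left y c
  have hx' : codimFix x + codimFix (x⁻¹ * c) = codimFix (x * (x⁻¹ * c)) := by rw [ex, hx]
  have hy' : codimFix y + codimFix (y⁻¹ * c) = codimFix (y * (y⁻¹ * c)) := by rw [ey, hy]
  have h1 : fixSpace (x⁻¹ * c) ≤ fixSpace (y⁻¹ * c) := by
    intro v hv
    rw [mem_fixSpace_right_iff hx', ex] at hv
    rw [mem_fixSpace_right_iff hy', ey]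
    exact Submodule.orthogonal_le hle hv
  have comp : ∀ (g : E ≃ₗᵢ[ℝ] E) {v : E}, v ∈ fixSpace (g⁻¹ * c) → c v = g v := by
    intro g v hv
    have := congrArg g (mem_fixSpace.mp hv)
    rwa [← Function.comp_apply (f := g), ← LinearIsometryEquiv.coe_mul,
      mul_inv_cancel_left] at this
  have h2 : fixSpace (x⁻¹ * c) ≤ fixSpace (x⁻¹ * y) := by
    intro v hv
    have e : x v = y v := (comp x hv).symm.trans (comp y (h1 hv))
    rw [mem_fixSpace, LinearIsometryEquiv.coe_mul, Function.comp_apply, ← e]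
    exact x.symm_apply_apply v
  have h3 : fixSpace y ≤ fixSpace (x⁻¹ * y) := by
    refine le_trans (le_inf ?_ le_rfl) (inf_fixSpace_le_mul _ _)
    rwa [fixSpace_inv]
  have h4 : fixSpace (x⁻¹ * c) ⊓ fixSpace y ≤ fixSpace c := by
    rintro v ⟨hv, hv'⟩
    rw [mem_fixSpace, comp x hv]
    exact mem_fixSpace.mp (hle hv')
  -- $\mathrm{Fix}(x^{-1}y)$ contains both spaces, which meet inside $\mathrm{Fix}\,c$. Counting
  -- dimensions bounds the codimension for $x^{-1}y$ by that of $y$ minus that of $x$; subadditivity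
  -- is the reverse bound.
  have d1 := Submodule.finrank_sup_add_finrank_inf_eq (fixSpace (x⁻¹ * c)) (fixSpace y)
  have d2 := Submodule.finrank_mono (sup_le h2 h3)
  have d3 := Submodule.finrank_mono h4
  have := finrank_fixSpace_add_codimFix y
  have := finrank_fixSpace_add_codimFix c
  have := finrank_fixSpace_add_codimFix (x⁻¹ * c)
  have := finrank_fixSpace_add_codimFix (x⁻¹ * y)
  have sub := codimFix_mul_le x (x⁻¹ * y)
  rw [mul_inv_cancel_left] at sub
  omega

end Orthogonal

/-! ### The permutation representation -/

section PermRepresentation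

variable {ι : Type*} [Fintype ι]

/-- The permutation representation on Euclidean space. -/
noncomputable def permIsometry (ι : Type*) [Fintype ι] :
    Equiv.Perm ι →* (EuclideanSpace ℝ ι ≃ₗᵢ[ℝ] EuclideanSpace ℝ ι) where
  toFun w := LinearIsometryEquiv.piLpCongrLeft 2 ℝ ℝ w
  map_one' := by ext v i; rfl
  map_mul' x y := by ext v i; rfl

theorem permIsometry_apply (w : Equiv.Perm ι) (v : EuclideanSpace ℝ ι) (i : ι) :
    permIsometry ι w v i = v (w⁻¹ i) := rfl

theorem mem_fixSpace_permIsometry {w : Equiv.Perm ι} {v : EuclideanSpace ℝ ι} :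
    v ∈ fixSpace (permIsometry ι w) ↔ ∀ i, v (w i) = v i := by
  rw [mem_fixSpace]
  constructor
  · intro h i
    have := congrArg (fun u : EuclideanSpace ℝ ι => u (w i)) h
    simpa [permIsometry_apply] using this.symm
  · intro h
    ext i
    rw [permIsometry_apply]
    have := h (w⁻¹ i)
    rw [← this]
    simp

end PermRepresentation

/-- A conjugation invariant length function on a group. -/
structure LengthFn (Γ : Type*) [Group Γ] where
  /-- the length -/
  len : Γ → ℕ
  len_one : len 1 = 0
  eq_one_of_len : ∀ {x}, len x = 0 → x = 1
  len_mul_le : ∀ x y, len (x * y) ≤ len x + len y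
  len_conj : ∀ x y, len (y * x * y⁻¹) = len x

/-! ### The absolute order of a length function -/

namespace LengthFn

variable {Γ : Type*} [Group Γ] (N : LengthFn Γ)

/-- The absolute order of a length function. -/
def Below (x y : Γ) : Prop := N.len x + N.len (x⁻¹ * y) = N.len y

variable {N} {x y z b u v : Γ}

theorem len_le_add (x y : Γ) : N.len y ≤ N.len x + N.len (x⁻¹ * y) := by
  have := N.len_mul_le x (x⁻¹ * y)
  rwa [mul_inv_cancel_left] at this

theorem below_of_le (h : N.len x + N.len (x⁻¹ * y) ≤ N.len y) : N.Below x y :=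
  le_antisymm h (len_le_add x y)

theorem Below.len_le (h : N.Below x y) : N.len x ≤ N.len y := by
  unfold Below at h
  omega

theorem Below.eq_of_len_le (h : N.Below x y) (hl : N.len y ≤ N.len x) : x = y := by
  unfold Below at h
  exact inv_mul_eq_one.mp (N.eq_one_of_len (by omega))

theorem below_refl (x : Γ) : N.Below x x := by simp [Below, N.len_one]

theorem one_below (x : Γ) : N.Below 1 x := by simp [Below, N.len_one]

theorem Below.antisymm (h : N.Below x y) (h' : N.Below y x) : x = y := h.eq_of_len_le h'.len_le

theorem Below.trans (h : N.Below x y) (h' : N.Below y z) : N.Below x z := by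
  apply below_of_le
  have e : x⁻¹ * z = x⁻¹ * y * (y⁻¹ * z) := by group
  have := N.len_mul_le (x⁻¹ * y) (y⁻¹ * z)
  rw [← e] at this
  unfold Below at h h'
  omega

/-- Conjugation invariance enters here: $(x^{-1}y)^{-1}y=y^{-1}xy$ has the length of $x$. Right
factors of a length-additive product are therefore left divisors too. -/
theorem Below.quotient_below (h : N.Below x y) : N.Below (x⁻¹ * y) y := by
  have := N.len_conj x y⁻¹
  unfold Below at *
  rw [inv_inv] at this
  rw [mul_inv_rev, inv_inv, this]
  omega

theorem Below.quotient_mono (h : N.Below b x) (h' : N.Below x y) :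
    N.Below (b⁻¹ * x) (b⁻¹ * y) := by
  have e : (b⁻¹ * x)⁻¹ * (b⁻¹ * y) = x⁻¹ * y := by group
  have := h.trans h'
  unfold Below at *
  rw [e]
  omega

theorem below_mul_of_below (h : N.Below b (b * v)) (h' : N.Below u v) :
    N.Below b (b * u) ∧ N.Below (b * u) (b * v) := by
  have e : (b * u)⁻¹ * (b * v) = u⁻¹ * v := by group
  have h1 := N.len_mul_le b u
  have h2 := len_le_add (N := N) (b * u) (b * v)
  unfold Below at *
  rw [inv_mul_cancel_left] at *
  rw [e] at *
  omega

end LengthFn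

open LengthFn

/-- The interval below `c` in the absolute order. -/
def Simple {Γ : Type*} [Group Γ] (N : LengthFn Γ) (c : Γ) : Type _ := {x : Γ // N.Below x c}

/-! ### The germ of simple elements and its complements -/

section Simple

variable {Γ : Type*} [Group Γ] {N : LengthFn Γ} {c : Γ}

instance : PartialOrder (Simple N c) where
  le x y := N.Below x.1 y.1
  le_refl x := below_refl x.1
  le_trans _ _ _ h h' := Below.trans h h'
  le_antisymm _ _ h h' := Subtype.ext (Below.antisymm h h')

theorem Simple.le_def {x y : Simple N c} : x ≤ y ↔ N.Below x.1 y.1 := Iff.rfl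

instance : OrderBot (Simple N c) where
  bot := ⟨1, one_below c⟩
  bot_le x := one_below x.1

instance : OrderTop (Simple N c) where
  top := ⟨c, below_refl c⟩
  le_top x := x.2

theorem Simple.bot_val : (⊥ : Simple N c).1 = 1 := rfl

theorem Simple.top_val : (⊤ : Simple N c).1 = c := rfl

/-- The right complement `x⁻¹ c`. -/
def Simple.compl (x : Simple N c) : Simple N c := ⟨x.1⁻¹ * c, x.2.quotient_below⟩

/-- The left quotient `x⁻¹ y` for `x ≤ y`. -/
def Simple.quot (x y : Simple N c) (h : x ≤ y) : Simple N c :=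
  ⟨x.1⁻¹ * y.1, (Below.quotient_below h).trans y.2⟩

theorem Simple.mul_below {x y : Simple N c} (h : y ≤ x.compl) :
    N.Below x.1 (x.1 * y.1) ∧ N.Below (x.1 * y.1) c := by
  have := below_mul_of_below (N := N) (b := x.1) (u := y.1) (v := x.1⁻¹ * c)
    (by rw [mul_inv_cancel_left]; exact x.2) h
  rwa [mul_inv_cancel_left] at this

/-- `z` is the product of `x` and `y` in the germ of simple elements. -/
def Simple.IsMul (x y z : Simple N c) : Prop := x ≤ z ∧ z.1 = x.1 * y.1

theorem Simple.IsMul.le_compl {x y z : Simple N c} (h : IsMul x y z) : y ≤ x.compl := by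
  have := Below.quotient_mono h.1 z.2
  rw [h.2, inv_mul_cancel_left] at this
  exact this

theorem Simple.isMul_compl (x : Simple N c) : IsMul x x.compl ⊤ :=
  ⟨le_top, (mul_inv_cancel_left x.1 c).symm⟩

theorem Simple.isMul_quot {x y : Simple N c} (h : x ≤ y) : IsMul x (x.quot y h) y :=
  ⟨h, (mul_inv_cancel_left x.1 y.1).symm⟩

namespace Simple

theorem compl_le_compl_of_isMul {a b s : Simple N c} (h : IsMul a b s) :
    s.compl ≤ b.compl := by
  have := Below.quotient_mono h.le_compl a.compl.2
  have e : b.1⁻¹ * (a.compl).1 = (s.compl).1 := by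
    simp only [compl, h.2]
    group
  rw [e] at this
  exact this

theorem compl_top : (⊤ : Simple N c).compl = ⊥ := by
  apply Subtype.ext
  simp [compl, top_val, bot_val]

/-- The sequence `s, L 0, L 1, …`. -/
def cons (s : Simple N c) (L : ℕ → Simple N c) : ℕ → Simple N c
  | 0 => s
  | i + 1 => L i

theorem cons_injective (s : Simple N c) : Function.Injective (cons s) := by
  intro L L' h
  funext i
  exact congrFun h (i + 1)

/-- Conjugation by `c`. -/
def twist (s : Simple N c) : Simple N c := s.compl.compl

theorem twist_val (s : Simple N c) : (twist s).1 = c⁻¹ * s.1 * c := by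
  simp only [twist, compl]
  group

theorem twist_iterate_val (s : Simple N c) (k : ℕ) :
    (twist^[k] s).1 = (c ^ k)⁻¹ * s.1 * c ^ k := by
  induction k generalizing s with
  | zero => simp
  | succ k ih =>
    rw [Function.iterate_succ_apply, ih, twist_val, pow_succ']
    group

theorem twist_iterate_orderOf (s : Simple N c) : twist^[orderOf c] s = s := by
  apply Subtype.ext
  rw [twist_iterate_val, pow_orderOf_eq_one]
  simp

end Simple

variable (N c) in
/-- Binary meets exist in the interval. -/
class HasMeets : Prop where
  exists_meet : ∀ x y : Simple N c, ∃ z, z ≤ x ∧ z ≤ y ∧ ∀ w, w ≤ x → w ≤ y → w ≤ z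

variable [HasMeets N c]

noncomputable instance : SemilatticeInf (Simple N c) where
  inf x y := Classical.choose (HasMeets.exists_meet x y)
  inf_le_left x y := (Classical.choose_spec (HasMeets.exists_meet x y)).1
  inf_le_right x y := (Classical.choose_spec (HasMeets.exists_meet x y)).2.1
  le_inf w x y h h' := (Classical.choose_spec (HasMeets.exists_meet x y)).2.2 w h h'

/-! ### Left multiplication on greedy sequences -/

namespace Simple

/-- The largest simple left divisor of the product of two simple elements. -/
noncomputable def head (s h : Simple N c) : Simple N c :=
  ⟨s.1 * (s.compl ⊓ h).1, (mul_below inf_le_left).2⟩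

/-- What remains of the product of two simple elements after division by the head. -/
noncomputable def tail (s h : Simple N c) : Simple N c := (s.compl ⊓ h).quot h inf_le_right

theorem head_val (s h : Simple N c) : (head s h).1 = s.1 * (s.compl ⊓ h).1 := rfl

theorem tail_val (s h : Simple N c) : (tail s h).1 = (s.compl ⊓ h).1⁻¹ * h.1 := rfl

theorem le_head (s h : Simple N c) : s ≤ head s h := (mul_below inf_le_left).1

/-- Left multiplication by $b$ carries divisors of `s.compl` to divisors of `a.compl`, because
`a.compl` is $b$ times `s.compl`. The meet on the left is above $b$, so it can be computed after
cancelling $b$. This is what makes heads, and then the whole action, multiplicative. -/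
theorem compl_inf_head {a b s : Simple N c} (hs : IsMul a b s) (h : Simple N c) :
    (a.compl ⊓ head b h).1 = b.1 * (s.compl ⊓ h).1 := by
  have e : b.1⁻¹ * (a.compl).1 = (s.compl).1 := by
    simp only [compl, hs.2]
    group
  have e' : (a.compl).1 = b.1 * (s.compl).1 := by rw [← e, mul_inv_cancel_left]
  have hb : b ≤ a.compl ⊓ head b h := le_inf hs.le_compl (le_head b h)
  have hle : s.compl ⊓ h ≤ b.compl := inf_le_left.trans (compl_le_compl_of_isMul hs)
  apply Below.antisymm (N := N)
  · set w := b.quot _ hb with hw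
    have h1 : w ≤ s.compl := by
      have := Below.quotient_mono hb (inf_le_left : a.compl ⊓ head b h ≤ _)
      rw [e] at this
      exact this
    have h2 : w ≤ h := by
      have := Below.quotient_mono hb (inf_le_right : a.compl ⊓ head b h ≤ _)
      rw [head_val, inv_mul_cancel_left] at this
      exact le_trans (b := b.compl ⊓ h) this inf_le_right
    have h3 := (below_mul_of_below (N := N) (b := b.1) (u := w.1) (v := (s.compl ⊓ h).1)
      (mul_below hle).1 (le_inf h1 h2)).2
    rwa [show b.1 * w.1 = (a.compl ⊓ head b h).1 from mul_inv_cancel_left _ _] at h3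
  · let p : Simple N c := ⟨b.1 * (s.compl ⊓ h).1, (mul_below hle).2⟩
    refine (le_inf ?_ ?_ : p ≤ a.compl ⊓ head b h)
    · rw [le_def, e']
      exact (below_mul_of_below (N := N) (e' ▸ hs.le_compl)
        (inf_le_left : s.compl ⊓ h ≤ _)).2
    · exact (below_mul_of_below (N := N) (le_head b h)
        (le_inf hle inf_le_right : s.compl ⊓ h ≤ b.compl ⊓ h)).2

theorem head_head {a b s : Simple N c} (hs : IsMul a b s) (h : Simple N c) :
    head a (head b h) = head s h := by
  apply Subtype.ext
  rw [head_val, compl_inf_head hs, head_val, hs.2, mul_assoc]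

theorem isMul_tail {a b s : Simple N c} (hs : IsMul a b s) (h : Simple N c) :
    IsMul (tail a (head b h)) (tail b h) (tail s h) := by
  have hle : s.compl ⊓ h ≤ b.compl ⊓ h :=
    inf_le_inf_right _ (compl_le_compl_of_isMul hs)
  have e : (tail a (head b h)).1 = (s.compl ⊓ h).1⁻¹ * (b.compl ⊓ h).1 := by
    rw [tail_val, compl_inf_head hs, head_val]
    group
  constructor
  · rw [le_def, e]
    exact Below.quotient_mono hle (inf_le_right : b.compl ⊓ h ≤ _)
  · rw [e, tail_val, tail_val]
    group

/-- The carries of the left multiplication of a sequence of simple elements by `s`. -/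
noncomputable def carry (s : Simple N c) (L : ℕ → Simple N c) : ℕ → Simple N c
  | 0 => s
  | i + 1 => tail (carry s L i) (L i)

/-- The left multiplication of a sequence of simple elements by `s`. -/
noncomputable def act (s : Simple N c) (L : ℕ → Simple N c) (i : ℕ) : Simple N c :=
  head (carry s L i) (L i)

theorem isMul_carry {a b s : Simple N c} (hs : IsMul a b s) (L : ℕ → Simple N c) (i : ℕ) :
    IsMul (carry a (act b L) i) (carry b L i) (carry s L i) := by
  induction i with
  | zero => exact hs
  | succ i ih => exact isMul_tail ih (L i)

theorem act_act {a b s : Simple N c} (hs : IsMul a b s) (L : ℕ → Simple N c) :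
    act a (act b L) = act s L :=
  funext fun i => head_head (isMul_carry hs L i) (L i)

/-- Consecutive terms of the sequence are left-greedy. -/
def Greedy (L : ℕ → Simple N c) : Prop := ∀ i, (L i).compl ⊓ L (i + 1) = ⊥

/-- Let $x$ be the part of $h_1$ absorbed by $a$ and $k$ the carry, so $h_1=xk$. A common divisor
$z$ of the two elements gives a divisor $xz$ of `a.compl`. Greediness of $(h_1,h_2)$ forces $z\le
k$, so $xz$ also divides $h_1$. By maximality of the meet, $xz=x$. -/
theorem compl_head_inf_head {a h₁ h₂ : Simple N c} (h : h₁.compl ⊓ h₂ = ⊥) :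
    (head a h₁).compl ⊓ head (tail a h₁) h₂ = ⊥ := by
  set x := a.compl ⊓ h₁ with hx
  set k := tail a h₁ with hk
  set z := (head a h₁).compl ⊓ head k h₂ with hz
  have hxa : IsMul a x (head a h₁) := ⟨le_head _ _, rfl⟩
  have hxk : IsMul x k h₁ := isMul_quot _
  -- the product `x z` is simple and divides `a.compl`
  have ez : x.1⁻¹ * (a.compl).1 = ((head a h₁).compl).1 := by
    change _ = (a.1 * x.1)⁻¹ * c
    rw [compl]
    group
  have hzx : z ≤ x.compl := inf_le_left.trans (compl_le_compl_of_isMul hxa)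
  let xz : Simple N c := ⟨x.1 * z.1, (mul_below hzx).2⟩
  have hxz : x ≤ xz := (mul_below hzx).1
  have h1 : xz ≤ a.compl := by
    have e' : (a.compl).1 = x.1 * ((head a h₁).compl).1 := by rw [← ez, mul_inv_cancel_left]
    rw [le_def, e']
    exact (below_mul_of_below (N := N) (e' ▸ hxa.le_compl)
      (inf_le_left : z ≤ _)).2
  -- `z` divides `k`
  have hkx : k ≤ x.compl ⊓ head k h₂ := le_inf hxk.le_compl (le_head _ _)
  set y := k.quot _ hkx with hy
  have hy1 : y ≤ h₁.compl := by
    have := Below.quotient_mono hkx (inf_le_left : x.compl ⊓ head k h₂ ≤ _)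
    have e : k.1⁻¹ * (x.compl).1 = (h₁.compl).1 := by
      simp only [compl, hxk.2]
      group
    rwa [e] at this
  have hy2 : y ≤ h₂ := by
    have := Below.quotient_mono hkx (inf_le_right : x.compl ⊓ head k h₂ ≤ _)
    rw [head_val, inv_mul_cancel_left] at this
    exact le_trans (b := k.compl ⊓ h₂) this inf_le_right
  have hy0 : y = ⊥ := le_bot_iff.mp (h ▸ le_inf hy1 hy2)
  have hk0 : x.compl ⊓ head k h₂ = k := by
    apply Subtype.ext
    have := (isMul_quot hkx).2
    rw [← hy, hy0, bot_val, mul_one] at this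
    exact this
  have hzk : z ≤ k := hk0 ▸ le_inf hzx inf_le_right
  have h2 : xz ≤ h₁ := by
    rw [le_def, hxk.2]
    exact (below_mul_of_below (N := N) (hxk.2 ▸ hxk.1) hzk).2
  have h3 : xz = x := le_antisymm (le_inf h1 h2) hxz
  apply Subtype.ext
  have := congrArg Subtype.val h3
  exact mul_eq_left.mp this

theorem Greedy.act {L : ℕ → Simple N c} (hL : Greedy L) (s : Simple N c) :
    Greedy (act s L) := fun i => compl_head_inf_head (hL i)

theorem compl_inf_top (s : Simple N c) : s.compl ⊓ ⊤ = s.compl := inf_of_le_left le_top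

theorem head_top (s : Simple N c) : head s ⊤ = ⊤ := by
  apply Subtype.ext
  rw [head_val, compl_inf_top]
  exact mul_inv_cancel_left _ _

theorem head_eq_of_inf {s h : Simple N c} (hi : s.compl ⊓ h = ⊥) : head s h = s := by
  apply Subtype.ext
  rw [head_val, hi, bot_val, mul_one]

theorem tail_eq_of_inf {s h : Simple N c} (hi : s.compl ⊓ h = ⊥) : tail s h = h := by
  apply Subtype.ext
  rw [tail_val, hi, bot_val, inv_one, one_mul]

theorem carry_of_greedy {s : Simple N c} {L : ℕ → Simple N c} (h : s.compl ⊓ L 0 = ⊥)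
    (hL : Greedy L) (i : ℕ) : carry s L (i + 1) = L i := by
  induction i with
  | zero => exact tail_eq_of_inf h
  | succ i ih =>
    rw [carry, ih]
    exact tail_eq_of_inf (hL i)

theorem act_eq_cons {s : Simple N c} {L : ℕ → Simple N c} (h : s.compl ⊓ L 0 = ⊥)
    (hL : Greedy L) : act s L = cons s L := by
  funext i
  cases i with
  | zero => exact head_eq_of_inf h
  | succ i =>
    rw [act, carry_of_greedy h hL]
    exact head_eq_of_inf (hL i)

theorem act_top {L : ℕ → Simple N c} (hL : Greedy L) : act ⊤ L = cons ⊤ L :=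
  act_eq_cons (by rw [compl_top, bot_inf_eq]) hL

/-- The head absorbs all it can and becomes $\top$; the carry is then `s.compl.compl`, the conjugate
of $s$ by $c$. This is the rule for moving $\delta$ past a simple element. -/
theorem act_cons_top (s : Simple N c) (L : ℕ → Simple N c) :
    act s (cons ⊤ L) = cons ⊤ (act (twist s) L) := by
  have h1 : ∀ i, carry s (cons ⊤ L) (i + 1) = carry (twist s) L i := by
    intro i
    induction i with
    | zero =>
      apply Subtype.ext
      change (tail s ⊤).1 = _
      rw [tail_val, compl_inf_top]
      rfl
    | succ i ih =>
      rw [carry, ih]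
      rfl
  funext i
  cases i with
  | zero => exact head_top s
  | succ i =>
    rw [act, h1]
    rfl

variable (N c) in
/-- The greedy sequences of simple elements. -/
def GreedySeq : Type _ := {L : ℕ → Simple N c // Greedy L}

/-- The left multiplication of greedy sequences by `s`. -/
noncomputable def actEnd (s : Simple N c) : Function.End (GreedySeq N c) :=
  fun L => ⟨act s L.1, L.2.act s⟩

theorem actEnd_mul {a b s : Simple N c} (hs : IsMul a b s) :
    actEnd a * actEnd b = actEnd s :=
  funext fun L => Subtype.ext (act_act hs L.1)

theorem actEnd_top_injective :
    Function.Injective (actEnd (⊤ : Simple N c) : GreedySeq N c → GreedySeq N c) := by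
  intro L L' h
  have := congrArg Subtype.val h
  change act ⊤ L.1 = act ⊤ L'.1 at this
  rw [act_top L.2, act_top L'.2] at this
  exact Subtype.ext (cons_injective _ this)

theorem actEnd_mul_top (s : Simple N c) :
    actEnd s * actEnd ⊤ = actEnd ⊤ * actEnd (twist s) := by
  funext L
  apply Subtype.ext
  change act s (act ⊤ L.1) = act ⊤ (act (twist s) L.1)
  rw [act_top L.2, act_cons_top, act_top (L.2.act _)]

theorem actEnd_mul_top_pow (s : Simple N c) (k : ℕ) :
    actEnd s * actEnd ⊤ ^ k = actEnd ⊤ ^ k * actEnd (twist^[k] s) := by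
  induction k generalizing s with
  | zero => simp
  | succ k ih => rw [pow_succ', ← mul_assoc, actEnd_mul_top, mul_assoc, ih, ← mul_assoc,
      Function.iterate_succ_apply]

/-- Moving $s$ past one $\top$ conjugates it by $c$, so moving it past `orderOf c` of them leaves it
unchanged. -/
theorem commute_actEnd (s : Simple N c) : Commute (actEnd s) (actEnd ⊤ ^ orderOf c) := by
  rw [Commute, SemiconjBy, actEnd_mul_top_pow, twist_iterate_orderOf]

end Simple

end Simple

open LengthFn
open scoped RealInnerProductSpace

/-! ### The absolute length of permutations -/

section PermLength

variable (ι : Type*) [Fintype ι]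

theorem permIsometry_injective : Function.Injective (permIsometry ι) := by
  classical
  rw [injective_iff_map_eq_one]
  intro w hw
  have h : ∀ v : EuclideanSpace ℝ ι, v ∈ fixSpace (permIsometry ι w) := by
    intro v
    rw [mem_fixSpace, hw]
    rfl
  ext i
  have := mem_fixSpace_permIsometry.mp (h (EuclideanSpace.single i 1)) i
  by_contra hne
  have hne' : w i ≠ i := hne
  simp [hne'] at this

/-- The absolute length of a permutation: the codimension of its fixed space. -/
noncomputable def permLen : LengthFn (Equiv.Perm ι) where
  len w := codimFix (permIsometry ι w)
  len_one := by rw [map_one, codimFix_one]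
  eq_one_of_len h := permIsometry_injective ι (by rw [codimFix_eq_zero h, map_one])
  len_mul_le x y := by rw [map_mul]; exact codimFix_mul_le _ _
  len_conj x y := by rw [map_mul, map_mul, map_inv]; exact codimFix_conj _ _

variable {ι}

/-- The function `f` is constant on the cycles of `w`. -/
def Inv (w : Equiv.Perm ι) (f : ι → ℝ) : Prop := ∀ i, f (w i) = f i

omit [Fintype ι] in
theorem Inv.mul {x y : Equiv.Perm ι} {f : ι → ℝ} (hx : Inv x f) (hy : Inv y f) :
    Inv (x * y) f := fun i => (hx (y i)).trans (hy i)

theorem mem_fixSpace_iff_inv {w : Equiv.Perm ι} {v : EuclideanSpace ℝ ι} :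
    v ∈ fixSpace (permIsometry ι w) ↔ Inv w (fun i => v i) := mem_fixSpace_permIsometry

theorem toLp_mem_fixSpace {w : Equiv.Perm ι} {f : ι → ℝ} :
    WithLp.toLp 2 f ∈ fixSpace (permIsometry ι w) ↔ Inv w f := mem_fixSpace_permIsometry

theorem inv_of_below {x y : Equiv.Perm ι} (h : (permLen ι).Below x y) {f : ι → ℝ}
    (hf : Inv y f) : Inv x f := by
  have h1 : codimFix (permIsometry ι x) + codimFix (permIsometry ι (x⁻¹ * y)) =
      codimFix (permIsometry ι x * permIsometry ι (x⁻¹ * y)) := by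
    rw [← map_mul, mul_inv_cancel_left]
    exact h
  have h2 := fixSpace_mul_eq h1
  rw [← map_mul, mul_inv_cancel_left] at h2
  rw [← toLp_mem_fixSpace, h2] at hf
  exact toLp_mem_fixSpace.mp hf.1

/-- Inside the interval below $c$, comparing permutations becomes comparing their invariant
functions, that is, their cycle partitions. -/
theorem below_of_inv {x y c : Equiv.Perm ι} (hx : (permLen ι).Below x c)
    (hy : (permLen ι).Below y c) (h : ∀ f, Inv y f → Inv x f) : (permLen ι).Below x y := by
  have := codimFix_add_of_fixSpace_le (c := permIsometry ι c) (x := permIsometry ι x)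
    (y := permIsometry ι y) (by rw [← map_inv, ← map_mul]; exact hx)
    (by rw [← map_inv, ← map_mul]; exact hy)
    (fun v hv => mem_fixSpace_iff_inv.mpr (h _ (mem_fixSpace_iff_inv.mp hv)))
  rw [← map_inv, ← map_mul] at this
  exact this

variable [DecidableEq ι]

omit [Fintype ι] in
theorem inv_swap {i j : ι} {f : ι → ℝ} : Inv (Equiv.swap i j) f ↔ f i = f j := by
  constructor
  · intro h
    have := h j
    rwa [Equiv.swap_apply_right] at this
  · intro h k
    rcases eq_or_ne k i with rfl | hi
    · rw [Equiv.swap_apply_left, h]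
    rcases eq_or_ne k j with rfl | hj
    · rw [Equiv.swap_apply_right, h]
    rw [Equiv.swap_apply_of_ne_of_ne hi hj]

theorem permLen_swap {i j : ι} (hij : i ≠ j) : (permLen ι).len (Equiv.swap i j) = 1 := by
  apply le_antisymm
  · set a : EuclideanSpace ℝ ι := EuclideanSpace.single i 1 - EuclideanSpace.single j 1 with ha
    have hle : (fixSpace (permIsometry ι (Equiv.swap i j)))ᗮ ≤ Submodule.span ℝ {a} := by
      intro u hu
      obtain ⟨v, rfl⟩ := exists_sub_eq_of_mem_orthogonal hu
      rw [Submodule.mem_span_singleton]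
      refine ⟨v j - v i, ?_⟩
      ext k
      rcases eq_or_ne k i with rfl | hi
      · simp [ha, permIsometry_apply, hij]
      rcases eq_or_ne k j with rfl | hj
      · simp [ha, permIsometry_apply, hi]
      · simp [ha, permIsometry_apply, hi, hj, Equiv.swap_apply_of_ne_of_ne]
    exact (Submodule.finrank_mono hle).trans
      ((finrank_span_le_card _).trans (by simp))
  · by_contra h
    have := (permLen ι).eq_one_of_len (x := Equiv.swap i j) (by omega)
    rw [Equiv.swap_eq_one_iff] at this
    exact hij this

theorem inner_single_sub_single (v : EuclideanSpace ℝ ι) (i j : ι) :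
    ⟪v, EuclideanSpace.single i 1 - EuclideanSpace.single j 1⟫ = v i - v j := by
  rw [inner_sub_right, EuclideanSpace.inner_single_right, EuclideanSpace.inner_single_right]
  simp

/-- For the converse, $e_i-e_j$ is orthogonal to $\mathrm{Fix}\,x$, hence equals $xv-v$ for some
$v$. The reflection $(i\,j)$ sends $xv$ back to $v$, so $(i\,j)x$ fixes $v$ besides all of
$\mathrm{Fix}\,x$, and its length drops. -/
theorem swap_below_iff {i j : ι} (hij : i ≠ j) {x : Equiv.Perm ι} :
    (permLen ι).Below (Equiv.swap i j) x ↔ ∀ f, Inv x f → f i = f j := by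
  constructor
  · exact fun h f hf => inv_swap.mp (inv_of_below h hf)
  · intro h
    set a : EuclideanSpace ℝ ι := EuclideanSpace.single i 1 - EuclideanSpace.single j 1 with ha
    have hmem : a ∈ (fixSpace (permIsometry ι x))ᗮ := by
      rw [Submodule.mem_orthogonal]
      intro v hv
      have := h _ (mem_fixSpace_iff_inv.mp hv)
      rw [ha, inner_single_sub_single]
      exact sub_eq_zero.mpr this
    obtain ⟨v, hv⟩ := exists_sub_eq_of_mem_orthogonal hmem
    have hvk : ∀ k, v (x⁻¹ k) = v k + a k := by
      intro k
      have := congrArg (fun u : EuclideanSpace ℝ ι => u k) hv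
      simp only [PiLp.sub_apply, permIsometry_apply] at this
      linarith
    -- Since $v+a=xv$ has the norm of $v$, one gets $2\langle v,a\rangle=-|a|^2=-2$.
    have hnorm : v j - v i = 1 := by
      have h1 : ⟪v + a, v + a⟫ = ⟪v, v⟫ := by
        rw [← hv, add_sub_cancel]
        exact (permIsometry ι x).inner_map_map v v
      have h2 : ⟪v, a⟫ = v i - v j := inner_single_sub_single v i j
      have h3 : ⟪a, a⟫ = 2 := by
        conv_lhs => arg 3; rw [ha]
        rw [inner_single_sub_single]
        simp [ha, hij, hij.symm]
        norm_num
      rw [inner_add_left, inner_add_right, inner_add_right, real_inner_comm v a, h2, h3] at h1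
      linarith
    have hv1 : Inv (Equiv.swap i j * x) (fun k => v k) := by
      intro k
      obtain ⟨k, rfl⟩ := (x⁻¹).surjective k
      rw [Equiv.Perm.mul_apply, show x (x⁻¹ k) = k from x.apply_symm_apply k]
      beta_reduce
      rw [hvk]
      rcases eq_or_ne k i with rfl | hi
      · simp [ha, hij]
        linarith
      rcases eq_or_ne k j with rfl | hj
      · simp [ha, hi]
        linarith
      · simp [ha, hi, hj, Equiv.swap_apply_of_ne_of_ne]
    have hlt : fixSpace (permIsometry ι x) < fixSpace (permIsometry ι (Equiv.swap i j * x)) := by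
      refine lt_of_le_of_ne ?_ ?_
      · intro u hu
        rw [mem_fixSpace_iff_inv] at hu ⊢
        exact (inv_swap.mpr (h _ hu)).mul hu
      · intro he
        have hv2 := mem_fixSpace_iff_inv.mpr hv1
        rw [← he] at hv2
        have := h _ (mem_fixSpace_iff_inv.mp hv2)
        linarith
    have d1 := Submodule.finrank_lt_finrank_of_lt hlt
    have d2 := finrank_fixSpace_add_codimFix (permIsometry ι x)
    have d3 := finrank_fixSpace_add_codimFix (permIsometry ι (Equiv.swap i j * x))
    apply below_of_le
    rw [permLen_swap hij, Equiv.swap_inv]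
    change 1 + codimFix (permIsometry ι (Equiv.swap i j * x)) ≤ codimFix (permIsometry ι x)
    omega

end PermLength

open LengthFn

/-! ### From braids to permutations -/

section Transpositions

variable {n : ℕ}

/-- The larger index of a band generator. -/
def Gen.hi (g : Gen n) : Fin (n + 1) := ⟨g.1.1, by have := g.2; omega⟩

/-- The smaller index of a band generator. -/
def Gen.lo (g : Gen n) : Fin (n + 1) := ⟨g.1.2, by have := g.2; omega⟩

theorem Gen.hi_ne_lo (g : Gen n) : g.hi ≠ g.lo := by
  have := g.2
  simp only [Gen.hi, Gen.lo, ne_eq, Fin.mk.injEq]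
  omega

/-- The transposition of a band generator. -/
def tr (g : Gen n) : Equiv.Perm (Fin (n + 1)) := Equiv.swap g.hi g.lo

theorem tr_inv (g : Gen n) : (tr g)⁻¹ = tr g := Equiv.swap_inv _ _

theorem tr_mul_tr_mul (g : Gen n) (x : Equiv.Perm (Fin (n + 1))) : tr g * (tr g * x) = x :=
  Equiv.swap_mul_self_mul _ _ _

theorem tr_apply_val (g : Gen n) (k : Fin (n + 1)) :
    (tr g k : ℕ) = if (k : ℕ) = g.1.1 then g.1.2 else if (k : ℕ) = g.1.2 then g.1.1 else k := by
  rw [tr, Equiv.swap_apply_def]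
  simp only [Gen.hi, Gen.lo, Fin.ext_iff]
  split_ifs <;> rfl

theorem unlinked_iff (x y : Gen n) : Unlinked x.1 y.1 ↔
    x.1.1 < y.1.2 ∨ y.1.1 < x.1.2 ∨ (x.1.2 < y.1.2 ∧ y.1.1 < x.1.1) ∨
      (y.1.2 < x.1.2 ∧ x.1.1 < y.1.1) := by
  obtain ⟨⟨t, s⟩, -, hst, -⟩ := x
  obtain ⟨⟨r, q⟩, -, hqr, -⟩ := y
  simp only [Unlinked] at *
  rw [mul_assoc]
  constructor
  · intro h
    by_contra hcon
    have hne : (t : ℤ) ≠ r ∧ (t : ℤ) ≠ q ∧ (s : ℤ) ≠ r ∧ (s : ℤ) ≠ q := by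
      refine ⟨?_, ?_, ?_, ?_⟩ <;> intro e <;> simp [e] at h
    have hc : (r < t ∧ s < r ∧ q < s) ∨ (t < r ∧ q < t ∧ s < q) := by omega
    rcases hc with ⟨h1, h2, h3⟩ | ⟨h1, h2, h3⟩
    · have e1 : (0 : ℤ) < (t - r) * (t - q) := mul_pos (by omega) (by omega)
      have e2 : ((s : ℤ) - r) * (s - q) < 0 := mul_neg_of_neg_of_pos (by omega) (by omega)
      have := mul_neg_of_pos_of_neg e1 e2
      omega
    · have e1 : ((t : ℤ) - r) * (t - q) < 0 := mul_neg_of_neg_of_pos (by omega) (by omega)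
      have e2 : (0 : ℤ) < ((s : ℤ) - r) * (s - q) := mul_pos_of_neg_of_neg (by omega) (by omega)
      have := mul_neg_of_neg_of_pos e1 e2
      omega
  · rintro (h | h | ⟨h, h'⟩ | ⟨h, h'⟩)
    · exact mul_pos (mul_pos_of_neg_of_neg (by omega) (by omega))
        (mul_pos_of_neg_of_neg (by omega) (by omega))
    · exact mul_pos (mul_pos (by omega) (by omega)) (mul_pos (by omega) (by omega))
    · exact mul_pos (mul_pos (by omega) (by omega))
        (mul_pos_of_neg_of_neg (by omega) (by omega))
    · exact mul_pos_of_neg_of_neg (mul_neg_of_neg_of_pos (by omega) (by omega))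
        (mul_neg_of_neg_of_pos (by omega) (by omega))

theorem tr_comm {x y : Gen n} (h : Unlinked x.1 y.1) : tr x * tr y = tr y * tr x := by
  rw [unlinked_iff] at h
  have hx := x.2
  have hy := y.2
  rw [tr, tr, Equiv.mul_swap_eq_swap_mul, Equiv.swap_apply_of_ne_of_ne,
    Equiv.swap_apply_of_ne_of_ne]
  all_goals
    simp only [Gen.hi, Gen.lo, ne_eq, Fin.mk.injEq]
    omega

theorem tr_tripleLeft {x y z : Gen n} (h : IsTriple x.1 y.1 z.1) :
    tr x * tr y = tr z * tr x := by
  obtain ⟨h1, h2, h3⟩ := h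
  have hx := x.2
  have hy := y.2
  have e1 : y.hi = x.lo := Fin.ext h2.symm
  have e2 : z.hi = x.hi := Fin.ext h1.symm
  have e3 : z.lo = y.lo := Fin.ext h3.symm
  rw [tr, tr, tr, Equiv.mul_swap_eq_swap_mul, e1, e2, e3, Equiv.swap_apply_right,
    Equiv.swap_apply_of_ne_of_ne]
  all_goals
    simp only [Gen.hi, Gen.lo, ne_eq, Fin.mk.injEq]
    omega

theorem tr_tripleRight {x y z : Gen n} (h : IsTriple x.1 y.1 z.1) :
    tr z * tr x = tr y * tr z := by
  obtain ⟨h1, h2, h3⟩ := h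
  have hx := x.2
  have hy := y.2
  have e1 : y.hi = x.lo := Fin.ext h2.symm
  have e2 : z.hi = x.hi := Fin.ext h1.symm
  have e3 : z.lo = y.lo := Fin.ext h3.symm
  rw [tr, tr, tr, Equiv.mul_swap_eq_swap_mul, e1, e2, e3, Equiv.swap_apply_left,
    Equiv.swap_apply_of_ne_of_ne, Equiv.swap_comm]
  all_goals
    simp only [Gen.hi, Gen.lo, ne_eq, Fin.mk.injEq]
    omega

variable (n) in
/-- The permutation of a braid. -/
def permHom : Braid n →* Equiv.Perm (Fin (n + 1)) :=
  PresentedGroup.toGroup (f := tr) (by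
    rintro _ (⟨x, y, h⟩ | ⟨x, y, z, h⟩ | ⟨x, y, z, h⟩)
    · simp only [map_mul, map_inv, FreeGroup.lift_apply_of]
      exact mul_inv_eq_one.mpr (tr_comm h)
    · simp only [map_mul, map_inv, FreeGroup.lift_apply_of]
      exact mul_inv_eq_one.mpr (tr_tripleLeft h)
    · simp only [map_mul, map_inv, FreeGroup.lift_apply_of]
      exact mul_inv_eq_one.mpr (tr_tripleRight h))

theorem permHom_gen (g : Gen n) : permHom n (gen g) = tr g := PresentedGroup.toGroup.of _

theorem permHom_desc_apply {t s : ℕ} (hs : 1 ≤ s) (hst : s ≤ t) (ht : t ≤ n)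
    (k : Fin (n + 1)) : (permHom n (desc n t s) k : ℕ) =
      if (k : ℕ) = s then t else if s < k ∧ k ≤ t then k - 1 else k := by
  induction t with
  | zero => omega
  | succ t ih =>
    rw [desc]
    by_cases h : s ≤ t
    · have h' : 1 ≤ t ∧ t < t + 1 ∧ t + 1 ≤ n := by omega
      rw [if_pos h, a, dif_pos h', map_mul, permHom_gen, Equiv.Perm.mul_apply, tr_apply_val,
        ih h (by omega)]
      dsimp only
      split_ifs <;> omega
    · rw [if_neg h, map_one, Equiv.Perm.one_apply]
      split_ifs <;> omega

variable (n) in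
/-- The Coxeter element: the permutation of `δ`. -/
def cox : Equiv.Perm (Fin (n + 1)) := permHom n (delta n)

end Transpositions

/-! ### Noncrossing permutations below the Coxeter element -/

section Coxeter

variable {n : ℕ}

theorem cox_apply (hn : 1 ≤ n) (k : Fin (n + 1)) : (cox n k : ℕ) =
    if (k : ℕ) = 1 then n else k - 1 := by
  rw [cox, delta, permHom_desc_apply le_rfl hn le_rfl]
  split_ifs <;> omega

theorem inv_desc {t s : ℕ} (hs : 1 ≤ s) (hst : s ≤ t) (ht : t ≤ n) {f : Fin (n + 1) → ℝ}
    (hf : Inv (permHom n (desc n t s)) f) (k : ℕ) (hsk : s ≤ k) (hkt : k ≤ t) :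
    f ⟨k, by omega⟩ = f ⟨s, by omega⟩ := by
  induction k, hsk using Nat.le_induction with
  | base => rfl
  | succ k hk ih =>
    rw [← ih (by omega), ← hf ⟨k + 1, by omega⟩]
    congr 1
    apply Fin.ext
    rw [permHom_desc_apply hs hst ht]
    dsimp only
    split_ifs <;> omega

theorem tr_below_desc {t s : ℕ} (hs : 1 ≤ s) (hst : s ≤ t) (ht : t ≤ n) (g : Gen n)
    (h1 : s ≤ g.1.2) (h2 : g.1.1 ≤ t) :
    (permLen (Fin (n + 1))).Below (tr g) (permHom n (desc n t s)) := by
  have := g.2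
  rw [tr, swap_below_iff g.hi_ne_lo]
  intro f hf
  exact (inv_desc hs hst ht hf g.1.1 (by omega) (by omega)).trans
    (inv_desc hs hst ht hf g.1.2 (by omega) (by omega)).symm

theorem permLen_tr (g : Gen n) : (permLen (Fin (n + 1))).len (tr g) = 1 :=
  permLen_swap g.hi_ne_lo

theorem len_eq_of_tr_below {g : Gen n} {x : Equiv.Perm (Fin (n + 1))}
    (h : (permLen (Fin (n + 1))).Below (tr g) x) :
    (permLen (Fin (n + 1))).len x = (permLen (Fin (n + 1))).len (tr g * x) + 1 := by
  unfold Below at h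
  rw [permLen_tr, tr_inv] at h
  omega

theorem permLen_desc {t s : ℕ} (hs : 1 ≤ s) (hst : s ≤ t) (ht : t ≤ n) :
    (permLen (Fin (n + 1))).len (permHom n (desc n t s)) = t - s := by
  induction t with
  | zero => omega
  | succ t ih =>
    by_cases h : s ≤ t
    · have h' : 1 ≤ t ∧ t < t + 1 ∧ t + 1 ≤ n := by omega
      rw [len_eq_of_tr_below (g := ⟨(t + 1, t), h'⟩)
        (tr_below_desc hs hst ht _ (by dsimp only; omega) (by dsimp only; omega)),
        desc, if_pos h, a, dif_pos h', map_mul, permHom_gen, tr_mul_tr_mul, ih h (by omega)]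
      omega
    · rw [desc, if_neg h, map_one, len_one]
      omega

theorem tr_below_cox (g : Gen n) : (permLen (Fin (n + 1))).Below (tr g) (cox n) := by
  have := g.2
  exact tr_below_desc le_rfl (by omega) le_rfl g (by omega) (by omega)

/-- The chord of `h` does not cross the arc of indices from `g.lo`, excluded, to `g.hi`. -/
def Noncross (g h : Gen n) : Prop :=
  (g.1.2 < h.1.1 ∧ h.1.1 ≤ g.1.1) ↔ (g.1.2 < h.1.2 ∧ h.1.2 ≤ g.1.1)

/-- The Coxeter element lowers indices cyclically. Multiplying by the transposition of $t>s$ cuts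
this $n$-cycle into one cycle on the indices in $(s,t]$ and one on the other positive indices. -/
theorem inv_tr_mul_cox {g : Gen n} {f : Fin (n + 1) → ℝ} (hf : Inv (tr g * cox n) f) :
    (∀ k, ∀ _ : g.1.2 < k, ∀ hk' : k ≤ g.1.1, f ⟨k, by have := g.2; omega⟩ = f g.hi) ∧
    (∀ k, ∀ _ : 1 ≤ k, ∀ hk' : k ≤ n, (k ≤ g.1.2 ∨ g.1.1 < k) →
      f ⟨k, by omega⟩ = f g.lo) := by
  obtain ⟨⟨t, s⟩, h1, h2, h3⟩ := g
  dsimp only at *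
  have step : ∀ k, ∀ _ : 1 ≤ k, ∀ _ : k + 1 ≤ n, k ≠ s → k ≠ t →
      f ⟨k + 1, by omega⟩ = f ⟨k, by omega⟩ := by
    intro k _ _ hs ht
    rw [← hf ⟨k + 1, by omega⟩]
    congr 1
    apply Fin.ext
    rw [Equiv.Perm.mul_apply, tr_apply_val, cox_apply (by omega)]
    dsimp only
    split_ifs <;> omega
  have jump : ∀ ht : t + 1 ≤ n, f ⟨t + 1, by omega⟩ = f ⟨s, by omega⟩ := by
    intro ht
    rw [← hf ⟨t + 1, by omega⟩]
    congr 1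
    apply Fin.ext
    rw [Equiv.Perm.mul_apply, tr_apply_val, cox_apply (by omega)]
    dsimp only
    split_ifs <;> omega
  constructor
  · intro k hk hk'
    have key : ∀ k, ∀ _ : s + 1 ≤ k, ∀ _ : k ≤ t,
        f ⟨k, by omega⟩ = f ⟨s + 1, by omega⟩ := by
      intro k hk
      induction k, hk using Nat.le_induction with
      | base => intro _; rfl
      | succ k hk ih =>
        intro hkt
        rw [step k (by omega) (by omega) (by omega) (by omega), ih (by omega)]
    exact (key k hk hk').trans (key t h2 le_rfl).symm
  · have low : ∀ k, ∀ _ : 1 ≤ k, ∀ _ : k ≤ s, f ⟨k, by omega⟩ = f ⟨1, by omega⟩ := by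
      intro k hk
      induction k, hk using Nat.le_induction with
      | base => intro _; rfl
      | succ k hk ih =>
        intro hks
        rw [step k (by omega) (by omega) (by omega) (by omega), ih (by omega)]
    have high : ∀ k, ∀ _ : t + 1 ≤ k, ∀ _ : k ≤ n, f ⟨k, by omega⟩ = f ⟨s, by omega⟩ := by
      intro k hk
      induction k, hk using Nat.le_induction with
      | base => exact jump
      | succ k hk ih =>
        intro hks
        rw [step k (by omega) (by omega) (by omega) (by omega), ih (by omega)]
    rintro k hk1 hk' (hk | hk)
    · exact (low k hk1 hk).trans (low s h1 le_rfl).symm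
    · exact high k hk hk'

theorem tr_below_tr_mul_cox_iff (g h : Gen n) :
    (permLen (Fin (n + 1))).Below (tr h) (tr g * cox n) ↔ Noncross g h := by
  have hg := g.2
  have hh := h.2
  rw [tr, swap_below_iff h.hi_ne_lo]
  constructor
  · intro H
    -- The indicator of one of the two cycles of `tr g * cox n`; it separates the endpoints of a
    -- crossing chord.
    set f : Fin (n + 1) → ℝ := fun k => if g.1.2 < (k : ℕ) ∧ (k : ℕ) ≤ g.1.1 then 1 else 0 with hf
    have hinv : Inv (tr g * cox n) f := by
      intro k
      simp only [hf]
      refine if_congr ?_ rfl rfl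
      rw [Equiv.Perm.mul_apply, tr_apply_val, cox_apply (by omega)]
      have := k.2
      split_ifs <;> omega
    have := H f hinv
    simp only [hf, Gen.hi, Gen.lo] at this
    unfold Noncross
    by_contra hcon
    rw [not_iff] at hcon
    by_cases h2 : g.1.2 < h.1.2 ∧ h.1.2 ≤ g.1.1
    · rw [if_pos h2, if_neg (fun h1 => (hcon.mpr h2) h1)] at this
      norm_num at this
    · rw [if_neg h2, if_pos (by by_contra h1; exact h2 (hcon.mp h1))] at this
      norm_num at this
  · intro H f hf
    obtain ⟨h1, h2⟩ := inv_tr_mul_cox hf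
    unfold Noncross at H
    by_cases hc : g.1.2 < h.1.1 ∧ h.1.1 ≤ g.1.1
    · have hc' := H.mp hc
      exact (h1 _ hc.1 hc.2).trans (h1 _ hc'.1 hc'.2).symm
    · exact (h2 _ (by omega) (by omega) (by omega)).trans
        (h2 _ (by omega) (by omega) (by omega)).symm

theorem tr_mul_below_iff {g h : Gen n} {x : Equiv.Perm (Fin (n + 1))}
    (hg : (permLen (Fin (n + 1))).Below (tr g) x)
    (hh : (permLen (Fin (n + 1))).Below (tr h) (tr g * x)) :
    (permLen (Fin (n + 1))).Below (tr g) (tr g * tr h) ∧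
      (permLen (Fin (n + 1))).Below (tr g * tr h) x := by
  have := below_mul_of_below (N := permLen (Fin (n + 1))) (b := tr g) (u := tr h)
    (v := tr g * x) (by rwa [tr_mul_tr_mul]) hh
  rwa [tr_mul_tr_mul] at this

theorem Noncross.mul_below {g h : Gen n} (H : Noncross g h) :
    (permLen (Fin (n + 1))).Below (tr g) (tr g * tr h) ∧
      (permLen (Fin (n + 1))).Below (tr g * tr h) (cox n) :=
  tr_mul_below_iff (tr_below_cox g) ((tr_below_tr_mul_cox_iff g h).mpr H)

theorem Noncross.mul_below_of_below {g h : Gen n} (H : Noncross g h)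
    {x : Equiv.Perm (Fin (n + 1))} (hx : (permLen (Fin (n + 1))).Below x (cox n))
    (hg : (permLen (Fin (n + 1))).Below (tr g) x) (hh : (permLen (Fin (n + 1))).Below (tr h) x) :
    (permLen (Fin (n + 1))).Below (tr g * tr h) x :=
  below_of_inv H.mul_below.2 hx fun _ hf => (inv_of_below hg hf).mul (inv_of_below hh hf)

/-- The chords of `g` and `h` cross, with `g.hi` the largest index. -/
def Cross (g h : Gen n) : Prop := h.1.1 < g.1.1 ∧ g.1.2 < h.1.1 ∧ h.1.2 < g.1.2

/-- Cycles of a permutation below the Coxeter element do not cross. If the crossing chords lay in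
different cycles, the transposition of $h$ would survive below $x$ after removing that of $g$, and
so below `tr g * cox n`, against `tr_below_tr_mul_cox_iff`. -/
theorem inv_of_cross {g h : Gen n} (H : Cross g h) {x : Equiv.Perm (Fin (n + 1))}
    (hx : (permLen (Fin (n + 1))).Below x (cox n))
    (hg : (permLen (Fin (n + 1))).Below (tr g) x) (hh : (permLen (Fin (n + 1))).Below (tr h) x)
    {f : Fin (n + 1) → ℝ} (hf : Inv x f) : f g.hi = f h.hi := by
  by_contra hne
  have eg : f g.hi = f g.lo := (swap_below_iff g.hi_ne_lo).mp hg f hf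
  have key : (permLen (Fin (n + 1))).Below (tr h) (tr g * x) := by
    rw [tr, swap_below_iff h.hi_ne_lo]
    intro u hu
    have eh : f h.hi = f h.lo := (swap_below_iff h.hi_ne_lo).mp hh f hf
    -- Cut $u$ off outside a level set of $f$. The level set contains the endpoints of $h$ and
    -- avoids those of $g$, so on it $x$ and `tr g * x` agree.
    have hinv : Inv x (fun k => if f k = f h.hi then u k else 0) := by
      intro k
      beta_reduce
      rw [hf k]
      by_cases hk : f k = f h.hi
      · rw [if_pos hk, if_pos hk, ← hu k, Equiv.Perm.mul_apply, tr,
          Equiv.swap_apply_of_ne_of_ne]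
        · intro e
          exact hne (by rw [← e, hf k, hk])
        · intro e
          exact hne (by rw [eg, ← e, hf k, hk])
      · rw [if_neg hk, if_neg hk]
    have := (swap_below_iff h.hi_ne_lo).mp hh _ hinv
    simpa [eh] using this
  have h1 := (tr_mul_below_iff hg key)
  have h2 := Below.quotient_mono h1.1 (h1.2.trans hx)
  rw [inv_mul_cancel_left, tr_inv, tr_below_tr_mul_cox_iff] at h2
  unfold Noncross Cross at *
  have := h.2
  omega

theorem exists_tr_below {x : Equiv.Perm (Fin (n + 1))}
    (hx : (permLen (Fin (n + 1))).Below x (cox n)) (h1 : x ≠ 1) :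
    ∃ g : Gen n, (permLen (Fin (n + 1))).Below (tr g) x := by
  obtain ⟨i, hi⟩ : ∃ i, x i ≠ i := by
    by_contra hcon
    push Not at hcon
    exact h1 (Equiv.ext hcon)
  have hn : 1 ≤ n := by
    by_contra hn
    have := i.2
    have := (x i).2
    exact hi (Fin.ext (by omega))
  -- Index $0$ is a spare point of `Fin (n + 1)`, fixed by the Coxeter element and hence by
  -- everything below it. Moved points are therefore genuine strand indices.
  have hz : Inv x (fun k => if k = 0 then (1 : ℝ) else 0) := by
    refine inv_of_below hx fun k => ?_
    refine if_congr ?_ rfl rfl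
    rw [Fin.ext_iff, Fin.ext_iff, cox_apply hn]
    simp only [Fin.val_zero]
    split_ifs <;> omega
  have h0 : x i = 0 ↔ i = 0 := by
    have := hz i
    by_cases e : i = 0 <;> by_cases e' : x i = 0 <;> simp_all
  have hi0 : i ≠ 0 := fun e => hi ((h0.mpr e).trans e.symm)
  have hx0 : x i ≠ 0 := fun e => hi0 (h0.mp e)
  have hb : (permLen (Fin (n + 1))).Below (Equiv.swap (x i) i) x :=
    (swap_below_iff hi).mpr fun f hf => hf i
  have b1 := Fin.pos_iff_ne_zero.mpr hi0
  have b2 := Fin.pos_iff_ne_zero.mpr hx0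
  rw [Fin.lt_def] at b1 b2
  have b3 : (i : ℕ) ≠ x i := fun e => hi (Fin.ext e.symm)
  rcases lt_or_gt_of_ne b3 with h | h
  · exact ⟨⟨(x i, i), b1, h, by omega⟩, hb⟩
  · rw [Equiv.swap_comm] at hb
    exact ⟨⟨(i, x i), b2, h, by omega⟩, hb⟩

end Coxeter

open LengthFn

/-! ### Connectivity of common atoms -/

section Joinable

variable {n : ℕ}

/-- The product `g h` is simple and equal to `h k` for some generator `k`. -/
def Joinable (g h : Gen n) : Prop :=
  Noncross g h ∧ ∃ k, Noncross h k ∧ gen g * gen h = gen h * gen k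

theorem joinable_of_unlinked {g h : Gen n} (H : Unlinked g.1 h.1) : Joinable g h := by
  refine ⟨?_, g, ?_, gen_comm g h H⟩
  all_goals
    rw [unlinked_iff] at H
    have := g.2
    have := h.2
    unfold Noncross
    omega

theorem joinable_of_triple {x y z : Gen n} (h : IsTriple x.1 y.1 z.1) :
    Joinable x y ∧ Joinable z x ∧ Joinable y z := by
  have e1 := gen_tripleLeft x y z h
  have e2 := gen_tripleRight x y z h
  obtain ⟨h1, h2, h3⟩ := h
  have hx := x.2
  have hy := y.2
  have hz := z.2
  have n1 : Noncross x y := by unfold Noncross; omega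
  have n2 : Noncross z x := by unfold Noncross; omega
  have n3 : Noncross y z := by unfold Noncross; omega
  exact ⟨⟨n1, z, n3, e1.trans e2⟩, ⟨n2, y, n1, e1.symm⟩, ⟨n3, x, n2, e2.symm⟩⟩

theorem joinable_or_of_shared {g h : Gen n} (hne : g ≠ h)
    (H : g.1.1 = h.1.1 ∨ g.1.1 = h.1.2 ∨ g.1.2 = h.1.1 ∨ g.1.2 = h.1.2) :
    Joinable g h ∨ Joinable h g := by
  obtain ⟨⟨t, s⟩, h1, h2, h3⟩ := g
  obtain ⟨⟨r, q⟩, h4, h5, h6⟩ := h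
  dsimp only at *
  have hne' : ¬ (t = r ∧ s = q) := by
    rintro ⟨rfl, rfl⟩
    exact hne rfl
  rcases H with rfl | rfl | rfl | rfl
  · rcases lt_or_gt_of_ne (fun e => hne' ⟨rfl, e⟩ : s ≠ q) with h | h
    · exact .inl (joinable_of_triple (x := ⟨(t, q), h4, h5, h6⟩) (y := ⟨(q, s), h1, h, by omega⟩)
        (z := ⟨(t, s), h1, h2, h3⟩) ⟨rfl, rfl, rfl⟩).2.1
    · exact .inr (joinable_of_triple (x := ⟨(t, s), h1, h2, h3⟩) (y := ⟨(s, q), h4, h, by omega⟩)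
        (z := ⟨(t, q), h4, h5, h6⟩) ⟨rfl, rfl, rfl⟩).2.1
  · exact .inr (joinable_of_triple (x := ⟨(r, t), h4, h5, h6⟩) (y := ⟨(t, s), h1, h2, h3⟩)
      (z := ⟨(r, s), h1, by dsimp only; omega, h6⟩) ⟨rfl, rfl, rfl⟩).1
  · exact .inl (joinable_of_triple (x := ⟨(t, s), h1, h2, h3⟩) (y := ⟨(s, q), h4, h5, h6⟩)
      (z := ⟨(t, q), h4, by dsimp only; omega, h3⟩) ⟨rfl, rfl, rfl⟩).1
  · rcases lt_or_gt_of_ne (fun e => hne' ⟨e, rfl⟩ : t ≠ r) with h | h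
    · exact .inl (joinable_of_triple (x := ⟨(r, t), by dsimp only; omega, h, h6⟩)
        (y := ⟨(t, s), h1, h2, h3⟩) (z := ⟨(r, s), h4, h5, h6⟩) ⟨rfl, rfl, rfl⟩).2.2
    · exact .inr (joinable_of_triple (x := ⟨(t, r), by dsimp only; omega, h, h3⟩)
        (y := ⟨(r, s), h4, h5, h6⟩) (z := ⟨(t, s), h1, h2, h3⟩) ⟨rfl, rfl, rfl⟩).2.2

theorem joinable_or_cross {g h : Gen n} (hne : g ≠ h) :
    Joinable g h ∨ Joinable h g ∨ Cross g h ∨ Cross h g := by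
  by_cases H : g.1.1 = h.1.1 ∨ g.1.1 = h.1.2 ∨ g.1.2 = h.1.1 ∨ g.1.2 = h.1.2
  · rcases joinable_or_of_shared hne H with h | h
    · exact .inl h
    · exact .inr (.inl h)
  · by_cases hU : Unlinked g.1 h.1
    · exact .inl (joinable_of_unlinked hU)
    · rw [unlinked_iff] at hU
      have := g.2
      have := h.2
      unfold Cross
      omega

variable {α : Type*} {D : Set (Equiv.Perm (Fin (n + 1)))} {φ : Gen n → α}

/-- Crossing chords satisfy no defining relation, but the chord $k$ joining their larger endpoints
shares an endpoint with each, and the noncrossing property puts $k$ below every element of $D$. Two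
joinable steps through $k$ connect $g$ to $h$. -/
theorem eq_of_cross (hD : ∀ x ∈ D, (permLen (Fin (n + 1))).Below x (cox n))
    (hφ : ∀ g h, Joinable g h → (∀ x ∈ D, (permLen (Fin (n + 1))).Below (tr g) x) →
      (∀ x ∈ D, (permLen (Fin (n + 1))).Below (tr h) x) → φ g = φ h)
    {g h : Gen n} (H : Cross g h) (hg : ∀ x ∈ D, (permLen (Fin (n + 1))).Below (tr g) x)
    (hh : ∀ x ∈ D, (permLen (Fin (n + 1))).Below (tr h) x) : φ g = φ h := by
  have H' := H
  unfold Cross at H'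
  have bg := g.2
  have bh := h.2
  have aux : ∀ {g h : Gen n}, g ≠ h →
      (g.1.1 = h.1.1 ∨ g.1.1 = h.1.2 ∨ g.1.2 = h.1.1 ∨ g.1.2 = h.1.2) →
      (∀ x ∈ D, (permLen (Fin (n + 1))).Below (tr g) x) →
      (∀ x ∈ D, (permLen (Fin (n + 1))).Below (tr h) x) → φ g = φ h := by
    intro g h hne H hg hh
    rcases joinable_or_of_shared hne H with h' | h'
    · exact hφ _ _ h' hg hh
    · exact (hφ _ _ h' hh hg).symm
  let k : Gen n := ⟨(g.1.1, h.1.1), by omega, H'.1, by omega⟩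
  have hk : ∀ x ∈ D, (permLen (Fin (n + 1))).Below (tr k) x := fun x hx =>
    (swap_below_iff k.hi_ne_lo).mpr fun f hf => inv_of_cross H (hD x hx) (hg x hx) (hh x hx) hf
  have n1 : g ≠ k := by
    intro e
    have := congrArg (fun g : Gen n => g.1.2) e
    simp only [k] at this
    omega
  have n2 : k ≠ h := by
    intro e
    have := congrArg (fun g : Gen n => g.1.1) e
    simp only [k] at this
    omega
  exact (aux n1 (.inl rfl) hg hk).trans (aux n2 (.inr (.inr (.inl rfl))) hk hh)

/-- A function on the atoms below all elements of `D` that agrees on joinable atoms is constant. -/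
theorem eq_of_joinable (hD : ∀ x ∈ D, (permLen (Fin (n + 1))).Below x (cox n))
    (hφ : ∀ g h, Joinable g h → (∀ x ∈ D, (permLen (Fin (n + 1))).Below (tr g) x) →
      (∀ x ∈ D, (permLen (Fin (n + 1))).Below (tr h) x) → φ g = φ h)
    {g h : Gen n} (hg : ∀ x ∈ D, (permLen (Fin (n + 1))).Below (tr g) x)
    (hh : ∀ x ∈ D, (permLen (Fin (n + 1))).Below (tr h) x) : φ g = φ h := by
  rcases eq_or_ne g h with rfl | hne
  · rfl
  rcases joinable_or_cross hne with h' | h' | h' | h'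
  · exact hφ _ _ h' hg hh
  · exact (hφ _ _ h' hh hg).symm
  · exact eq_of_cross hD hφ h' hg hh
  · exact (eq_of_cross hD hφ h' hh hg).symm

theorem Joinable.tr_mul {g h : Gen n} (H : Joinable g h) :
    ∃ k, Noncross h k ∧ gen g * gen h = gen h * gen k ∧ tr g * tr h = tr h * tr k := by
  obtain ⟨-, k, hk, e⟩ := H
  refine ⟨k, hk, e, ?_⟩
  have := congrArg (permHom n) e
  simpa only [map_mul, permHom_gen] using this

end Joinable

/-! ### Existence of meets -/

section Meets

variable {n : ℕ}

theorem exists_meet_below (m : ℕ) : ∀ x y : Equiv.Perm (Fin (n + 1)),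
    (permLen (Fin (n + 1))).len x = m →
    (permLen (Fin (n + 1))).Below x (cox n) → (permLen (Fin (n + 1))).Below y (cox n) →
    ∃ z, (permLen (Fin (n + 1))).Below z x ∧ (permLen (Fin (n + 1))).Below z y ∧
      ∀ w, (permLen (Fin (n + 1))).Below w x → (permLen (Fin (n + 1))).Below w y →
        (permLen (Fin (n + 1))).Below w z := by
  induction m with
  | zero =>
    intro x y hx _ _
    have := eq_one_of_len _ hx
    subst this
    exact ⟨1, below_refl 1, one_below y, fun w h _ => h⟩
  | succ m ih =>
    intro x y hm hx hy
    -- the largest common divisor above a common atom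
    have hz : ∀ g : Gen n, ∃ z, (permLen (Fin (n + 1))).Below (tr g) x →
        (permLen (Fin (n + 1))).Below (tr g) y →
        (permLen (Fin (n + 1))).Below (tr g) z ∧ (permLen (Fin (n + 1))).Below z x ∧
        (permLen (Fin (n + 1))).Below z y ∧ ∀ w, (permLen (Fin (n + 1))).Below (tr g) w →
        (permLen (Fin (n + 1))).Below w x → (permLen (Fin (n + 1))).Below w y →
        (permLen (Fin (n + 1))).Below w z := by
      intro g
      by_cases hg : (permLen (Fin (n + 1))).Below (tr g) x ∧
          (permLen (Fin (n + 1))).Below (tr g) y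
      · obtain ⟨hgx, hgy⟩ := hg
        have b : ∀ x, (permLen (Fin (n + 1))).Below (tr g) x →
            (permLen (Fin (n + 1))).Below (tr g * x) x := by
          intro x h
          have := h.quotient_below
          rwa [tr_inv] at this
        have hlen := len_eq_of_tr_below hgx
        obtain ⟨z, h1, h2, h3⟩ := ih (tr g * x) (tr g * y) (by omega) ((b x hgx).trans hx)
          ((b y hgy).trans hy)
        have c : ∀ x, (permLen (Fin (n + 1))).Below (tr g) x →
            (permLen (Fin (n + 1))).Below z (tr g * x) →
            (permLen (Fin (n + 1))).Below (tr g) (tr g * z) ∧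
            (permLen (Fin (n + 1))).Below (tr g * z) x := by
          intro x h h'
          have := below_mul_of_below (N := permLen (Fin (n + 1))) (b := tr g) (u := z)
            (v := tr g * x) (by rwa [tr_mul_tr_mul]) h'
          rwa [tr_mul_tr_mul] at this
        refine ⟨tr g * z, fun _ _ => ⟨(c x hgx h1).1, (c x hgx h1).2, (c y hgy h2).2, ?_⟩⟩
        intro w hw hwx hwy
        have q1 := Below.quotient_mono hw hwx
        have q2 := Below.quotient_mono hw hwy
        rw [tr_inv] at q1 q2
        have := below_mul_of_below (N := permLen (Fin (n + 1))) (b := tr g) (u := tr g * w)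
          (v := z) (c x hgx h1).1 (h3 _ q1 q2)
        rw [tr_mul_tr_mul] at this
        exact this.2
      · exact ⟨1, fun h h' => absurd ⟨h, h'⟩ hg⟩
    choose z hz using hz
    have hD : ∀ u ∈ ({x, y} : Set (Equiv.Perm (Fin (n + 1)))),
        (permLen (Fin (n + 1))).Below u (cox n) := by
      rintro u (rfl | rfl)
      exacts [hx, hy]
    have hφ : ∀ g h, Joinable g h →
        (∀ u ∈ ({x, y} : Set (Equiv.Perm (Fin (n + 1)))),
          (permLen (Fin (n + 1))).Below (tr g) u) →
        (∀ u ∈ ({x, y} : Set (Equiv.Perm (Fin (n + 1)))),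
          (permLen (Fin (n + 1))).Below (tr h) u) → z g = z h := by
      intro g h H hg hh
      obtain ⟨g1, g2, g3, g4⟩ := hz g (hg x (.inl rfl)) (hg y (.inr rfl))
      obtain ⟨h1, h2, h3, h4⟩ := hz h (hh x (.inl rfl)) (hh y (.inr rfl))
      -- The simple product $gh=hk$ is a common divisor of $x$ and $y$ lying above both atoms. Hence
      -- $g$ lies below the maximal divisor over $h$ and conversely, so the two maximal divisors
      -- dominate each other.
      have jx := H.1.mul_below_of_below hx (hg x (.inl rfl)) (hh x (.inl rfl))
      have jy := H.1.mul_below_of_below hy (hg y (.inr rfl)) (hh y (.inr rfl))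
      obtain ⟨k, hk, -, e⟩ := H.tr_mul
      have lg := H.1.mul_below.1
      have lh := hk.mul_below.1
      rw [← e] at lh
      exact Below.antisymm (h4 _ (lh.trans (g4 _ lg jx jy)) g2 g3)
        (g4 _ (lg.trans (h4 _ lh jx jy)) h2 h3)
    by_cases hex : ∃ g : Gen n, (permLen (Fin (n + 1))).Below (tr g) x ∧
        (permLen (Fin (n + 1))).Below (tr g) y
    · obtain ⟨g, hgx, hgy⟩ := hex
      obtain ⟨g1, g2, g3, g4⟩ := hz g hgx hgy
      refine ⟨z g, g2, g3, fun w hwx hwy => ?_⟩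
      by_cases hw : w = 1
      · rw [hw]
        exact one_below _
      obtain ⟨h, hh⟩ := exists_tr_below (hwx.trans hx) hw
      rw [eq_of_joinable hD hφ (g := g) (h := h) (by rintro u (rfl | rfl) <;> assumption)
        (by rintro u (rfl | rfl); exacts [hh.trans hwx, hh.trans hwy])]
      exact (hz h (hh.trans hwx) (hh.trans hwy)).2.2.2 w hh hwx hwy
    · refine ⟨1, one_below x, one_below y, fun w hwx hwy => ?_⟩
      by_cases hw : w = 1
      · rw [hw]
        exact one_below _
      obtain ⟨h, hh⟩ := exists_tr_below (hwx.trans hx) hw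
      exact absurd ⟨h, hh.trans hwx, hh.trans hwy⟩ hex

variable (n) in
/-- The simple elements of the dual braid monoid, as permutations. -/
abbrev NC : Type := Simple (permLen (Fin (n + 1))) (cox n)

instance : HasMeets (permLen (Fin (n + 1))) (cox n) where
  exists_meet x y := by
    obtain ⟨z, h1, h2, h3⟩ := exists_meet_below _ x.1 y.1 rfl x.2 y.2
    exact ⟨⟨z, h1.trans x.2⟩, h1, h2, fun w => h3 w.1⟩

end Meets

/-! ### Independence of the reduced word -/

section ReducedWords

variable {n : ℕ}

/-- The braid of a word in the band generators. -/
def word (w : List (Gen n)) : Braid n := (w.map gen).prod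

theorem word_nil : word ([] : List (Gen n)) = 1 := rfl

theorem word_cons (g : Gen n) (w : List (Gen n)) : word (g :: w) = gen g * word w :=
  List.prod_cons

theorem word_append (w w' : List (Gen n)) : word (w ++ w') = word w * word w' := by
  rw [word, List.map_append, List.prod_append]
  rfl

theorem exists_word_of_mem_pos {P : Braid n} (h : P ∈ Pos n) : ∃ w, P = word w := by
  induction h using Submonoid.closure_induction with
  | mem x hx =>
    obtain ⟨g, rfl⟩ := hx
    exact ⟨[g], (mul_one _).symm⟩
  | one => exact ⟨[], rfl⟩
  | mul x y _ _ hx hy =>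
    obtain ⟨w, rfl⟩ := hx
    obtain ⟨w', rfl⟩ := hy
    exact ⟨w ++ w', (word_append w w').symm⟩

theorem word_mem_pos (w : List (Gen n)) : word w ∈ Pos n :=
  Submonoid.list_prod_mem _ fun x hx => by
    obtain ⟨g, -, rfl⟩ := List.mem_map.mp hx
    exact Submonoid.subset_closure ⟨g, rfl⟩

/-- `w` is a word of minimal length for the permutation `x`. -/
def IsReduced (x : Equiv.Perm (Fin (n + 1))) (w : List (Gen n)) : Prop :=
  permHom n (word w) = x ∧ (permLen (Fin (n + 1))).len x = w.length

theorem IsReduced.cons {g : Gen n} {x : Equiv.Perm (Fin (n + 1))} {w : List (Gen n)}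
    (hg : (permLen (Fin (n + 1))).Below (tr g) x) (h : IsReduced (tr g * x) w) :
    IsReduced x (g :: w) := by
  refine ⟨?_, ?_⟩
  · rw [word_cons, map_mul, permHom_gen, h.1, tr_mul_tr_mul]
  · rw [len_eq_of_tr_below hg, h.2, List.length_cons]

theorem permLen_permHom_word_le (w : List (Gen n)) :
    (permLen (Fin (n + 1))).len (permHom n (word w)) ≤ w.length := by
  induction w with
  | nil => rw [word_nil, map_one, len_one]; rfl
  | cons g w ih =>
    rw [word_cons, map_mul, permHom_gen, List.length_cons]
    have := len_mul_le (permLen (Fin (n + 1))) (tr g) (permHom n (word w))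
    rw [permLen_tr] at this
    omega

theorem IsReduced.of_cons {g : Gen n} {x : Equiv.Perm (Fin (n + 1))} {w : List (Gen n)}
    (h : IsReduced x (g :: w)) :
    (permLen (Fin (n + 1))).Below (tr g) x ∧ IsReduced (tr g * x) w := by
  have e : tr g * x = permHom n (word w) := by
    rw [← h.1, word_cons, map_mul, permHom_gen, tr_mul_tr_mul]
  have h1 := permLen_permHom_word_le w
  have h2 := h.2
  rw [List.length_cons] at h2
  have hb : (permLen (Fin (n + 1))).Below (tr g) x := by
    apply below_of_le
    rw [permLen_tr, tr_inv, e]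
    omega
  refine ⟨hb, e.symm, ?_⟩
  have := len_eq_of_tr_below hb
  omega

theorem exists_isReduced (m : ℕ) : ∀ x : Equiv.Perm (Fin (n + 1)),
    (permLen (Fin (n + 1))).len x = m → (permLen (Fin (n + 1))).Below x (cox n) →
    ∃ w, IsReduced x w := by
  induction m with
  | zero =>
    intro x hx _
    have := eq_one_of_len _ hx
    subst this
    exact ⟨[], map_one _, hx⟩
  | succ m ih =>
    intro x hm hx
    have h1 : x ≠ 1 := by
      rintro rfl
      rw [len_one] at hm
      omega
    obtain ⟨g, hg⟩ := exists_tr_below hx h1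
    have hb := hg.quotient_below
    rw [tr_inv] at hb
    have hlen := len_eq_of_tr_below hg
    obtain ⟨w, hw⟩ := ih (tr g * x) (by omega) (hb.trans hx)
    exact ⟨g :: w, hw.cons hg⟩

/-- Reduced words of the same simple element represent the same braid. -/
theorem word_eq_of_isReduced (m : ℕ) : ∀ x : Equiv.Perm (Fin (n + 1)),
    (permLen (Fin (n + 1))).len x = m → (permLen (Fin (n + 1))).Below x (cox n) →
    ∀ w w', IsReduced x w → IsReduced x w' → word w = word w' := by
  induction m using Nat.strong_induction_on with
  | _ m ih =>
    intro x hm hx w w' hw hw'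
    have hex : ∀ g : Gen n, ∃ v, (permLen (Fin (n + 1))).Below (tr g) x →
        IsReduced (tr g * x) v := by
      intro g
      by_cases hg : (permLen (Fin (n + 1))).Below (tr g) x
      · have hb := hg.quotient_below
        rw [tr_inv] at hb
        obtain ⟨v, hv⟩ := exists_isReduced _ (tr g * x) rfl (hb.trans hx)
        exact ⟨v, fun _ => hv⟩
      · exact ⟨[], fun h => absurd h hg⟩
    choose v hv using hex
    have same : ∀ g w, (permLen (Fin (n + 1))).Below (tr g) x → IsReduced (tr g * x) w →
        word w = word (v g) := by
      intro g w hg hw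
      have hb := hg.quotient_below
      rw [tr_inv] at hb
      have hlen := len_eq_of_tr_below hg
      exact ih _ (by omega) _ rfl (hb.trans hx) _ _ hw (hv g hg)
    have hD : ∀ u ∈ ({x} : Set (Equiv.Perm (Fin (n + 1)))),
        (permLen (Fin (n + 1))).Below u (cox n) := by
      rintro u rfl
      exact hx
    have hφ : ∀ g h, Joinable g h →
        (∀ u ∈ ({x} : Set (Equiv.Perm (Fin (n + 1)))),
          (permLen (Fin (n + 1))).Below (tr g) u) →
        (∀ u ∈ ({x} : Set (Equiv.Perm (Fin (n + 1)))),
          (permLen (Fin (n + 1))).Below (tr h) u) →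
        gen g * word (v g) = gen h * word (v h) := by
      intro g h H hg hh
      -- Complete $gh=hk$ by one reduced word $u$ of the remaining quotient. The induction
      -- hypothesis allows `v g` to be replaced by $hu$ and `v h` by $ku$, and the two braids agree
      -- by a defining relation.
      have jx := H.1.mul_below_of_below hx (hg x rfl) (hh x rfl)
      obtain ⟨k, hk, e, e'⟩ := H.tr_mul
      have bj := jx.quotient_below
      obtain ⟨u, hu⟩ := exists_isReduced _ _ rfl (bj.trans hx)
      have split : ∀ {g h : Gen n}, (permLen (Fin (n + 1))).Below (tr g) (tr g * tr h) →
          (permLen (Fin (n + 1))).Below (tr g * tr h) x →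
          IsReduced ((tr g * tr h)⁻¹ * x) u → IsReduced (tr g * x) (h :: u) := by
        intro g h h1 h2 h3
        have q := Below.quotient_mono h1 h2
        rw [inv_mul_cancel_left, tr_inv] at q
        refine IsReduced.cons q ?_
        rwa [mul_inv_rev, tr_inv, tr_inv, mul_assoc] at h3
      have r1 := split H.1.mul_below.1 jx hu
      have r2 := split hk.mul_below.1 (e' ▸ jx) (e' ▸ hu)
      rw [← same g _ (hg x rfl) r1, ← same h _ (hh x rfl) r2, word_cons, word_cons,
        ← mul_assoc, ← mul_assoc, e]
    cases w with
    | nil =>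
      have h1 := hw.2
      have h2 := hw'.2
      rw [h1] at h2
      rw [List.length_eq_zero_iff.mp h2.symm]
    | cons g w =>
      cases w' with
      | nil =>
        have h1 := hw.2
        have h2 := hw'.2
        rw [h1] at h2
        simp at h2
      | cons g' w' =>
        obtain ⟨b, c⟩ := hw.of_cons
        obtain ⟨b', c'⟩ := hw'.of_cons
        rw [word_cons, word_cons, same g w b c, same g' w' b' c']
        exact eq_of_joinable hD hφ (g := g) (h := g') (by rintro u rfl; exact b)
          (by rintro u rfl; exact b')

end ReducedWords

open LengthFn

/-! ### Inverting a central cancellable element -/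

section CentralLocalization

universe u

variable {R : Type u} [Monoid R] {D : R}

/-- The powers of a central cancellable element form an Ore set. -/
@[reducible]
def oreSetPowers (hc : ∀ r, Commute r D) (hi : ∀ r r', D * r = D * r' → r = r') :
    OreLocalization.OreSet (Submonoid.powers D) where
  ore_right_cancel r₁ r₂ s h := by
    obtain ⟨s, k, rfl⟩ := s
    refine ⟨1, ?_⟩
    change r₁ * D ^ k = r₂ * D ^ k at h
    rw [((hc r₁).pow_right k).eq, ((hc r₂).pow_right k).eq] at h
    congr 1
    induction k with
    | zero => simpa using h
    | succ k ih =>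
      rw [pow_succ', mul_assoc, mul_assoc] at h
      exact ih (hi _ _ h)
  oreNum r _ := r
  oreDenom _ s := s
  ore_eq r s := by
    obtain ⟨s, k, rfl⟩ := s
    exact ((hc r).pow_right k).eq.symm

/-- A monoid embeds into a monoid in which a given central cancellable element is a unit. -/
theorem exists_injective_isUnit (hc : ∀ r, Commute r D) (hi : ∀ r r', D * r = D * r' → r = r') :
    ∃ (K : Type u) (_ : Monoid K) (j : R →* K), Function.Injective j ∧ IsUnit (j D) := by
  let _ := oreSetPowers hc hi
  refine ⟨OreLocalization (Submonoid.powers D) R, inferInstance, OreLocalization.numeratorHom,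
    ?_, OreLocalization.numerator_isUnit (⟨D, Submonoid.mem_powers D⟩ : Submonoid.powers D)⟩
  intro r r' h
  rw [OreLocalization.numeratorHom_apply, OreLocalization.numeratorHom_apply,
    OreLocalization.oreDiv_eq_iff] at h
  obtain ⟨⟨_, k, rfl⟩, v, h1, h2⟩ := h
  change D ^ k * r' = v * r at h1
  change D ^ k * 1 = v * 1 at h2
  rw [mul_one, mul_one] at h2
  rw [← h2] at h1
  clear h2
  induction k with
  | zero => simpa using h1.symm
  | succ k ih =>
    rw [pow_succ', mul_assoc, mul_assoc] at h1
    exact ih (hi _ _ h1)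

theorem isUnit_of_mul_isUnit {x u v : R} (hu : IsUnit (x * u)) (hv : IsUnit (v * x)) :
    IsUnit x := by
  obtain ⟨a, ha⟩ := hu
  obtain ⟨b, hb⟩ := hv
  refine isUnit_iff_exists_and_exists.mpr ⟨⟨u * ↑a⁻¹, ?_⟩, ⟨↑b⁻¹ * v, ?_⟩⟩
  · rw [← mul_assoc, ← ha, Units.mul_inv]
  · rw [mul_assoc, ← hb, Units.inv_mul]

end CentralLocalization

/-! ### The action of positive words depends only on the braid -/

section WordAction

variable {n : ℕ}

/-- A band generator as a simple element. -/
def atom (g : Gen n) : NC n := ⟨tr g, tr_below_cox g⟩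

open Simple

theorem actEnd_atom_mul_eq {g h k l : Gen n} (H : Noncross g h) (H' : Noncross k l)
    (e : tr g * tr h = tr k * tr l) :
    actEnd (atom g) * actEnd (atom h) = actEnd (atom k) * actEnd (atom l) := by
  let s : NC n := ⟨tr g * tr h, H.mul_below.2⟩
  have h1 : IsMul (atom g) (atom h) s := ⟨H.mul_below.1, rfl⟩
  have h2 : IsMul (atom k) (atom l) s := by
    refine ⟨?_, e⟩
    have := H'.mul_below.1
    rw [← e] at this
    exact this
  rw [actEnd_mul h1, actEnd_mul h2]

theorem actEnd_top_pow_injective (k : ℕ) : Function.Injective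
    ((actEnd (⊤ : NC n) ^ k : Function.End (GreedySeq (permLen (Fin (n + 1))) (cox n))) :
      GreedySeq (permLen (Fin (n + 1))) (cox n) → GreedySeq _ _) := by
  induction k with
  | zero => exact Function.injective_id
  | succ k ih =>
    rw [pow_succ]
    exact ih.comp actEnd_top_injective

theorem actEnd_atom_relator_comm {x y : Gen n} (h : Unlinked x.1 y.1) :
    actEnd (atom x) * actEnd (atom y) = actEnd (atom y) * actEnd (atom x) := by
  have h' : Unlinked y.1 x.1 := by
    rw [unlinked_iff] at *
    omega
  exact actEnd_atom_mul_eq (joinable_of_unlinked h).1 (joinable_of_unlinked h').1 (tr_comm h)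

theorem actEnd_atom_relator_left {x y z : Gen n} (h : IsTriple x.1 y.1 z.1) :
    actEnd (atom x) * actEnd (atom y) = actEnd (atom z) * actEnd (atom x) :=
  actEnd_atom_mul_eq (joinable_of_triple h).1.1 (joinable_of_triple h).2.1.1 (tr_tripleLeft h)

theorem actEnd_atom_relator_right {x y z : Gen n} (h : IsTriple x.1 y.1 z.1) :
    actEnd (atom z) * actEnd (atom x) = actEnd (atom y) * actEnd (atom z) :=
  actEnd_atom_mul_eq (joinable_of_triple h).2.1.1 (joinable_of_triple h).2.2.1 (tr_tripleRight h)

/-- The action of a word in the band generators on greedy sequences. -/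
noncomputable def actWord (w : List (Gen n)) :
    Function.End (GreedySeq (permLen (Fin (n + 1))) (cox n)) :=
  (w.map fun g => actEnd (atom g)).prod

/-- Words that represent the same braid act equally on greedy sequences. -/
theorem actWord_eq_of_word_eq {w w' : List (Gen n)} (h : word w = word w') :
    actWord w = actWord w' := by
  -- The generators need not act invertibly, so the group presentation cannot be applied directly.
  -- In the centralizer of $D=\top^N$, however, $D$ is central and cancellable, and the localization
  -- $K$ at $D$ contains this centralizer.
  set N := orderOf (cox n) with hN
  have hNpos : 0 < N := orderOf_pos _
  obtain ⟨M, hM⟩ : ∃ M, N = M + 1 := ⟨N - 1, by omega⟩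
  set D : Function.End (GreedySeq (permLen (Fin (n + 1))) (cox n)) := actEnd ⊤ ^ N with hD
  let R := Submonoid.centralizer {D}
  have mem : ∀ s : NC n, actEnd s ∈ R := fun s =>
    Submonoid.mem_centralizer_iff.mpr fun _ hd => by
      rw [Set.mem_singleton_iff.mp hd]
      exact (commute_actEnd s).eq.symm
  have memD : D ∈ R := pow_mem (mem ⊤) _
  have hc : ∀ r : R, Commute r (⟨D, memD⟩ : R) := fun r =>
    Subtype.ext (Submonoid.mem_centralizer_iff.mp r.2 D rfl).symm
  have hinj : Function.Injective
      (D : GreedySeq (permLen (Fin (n + 1))) (cox n) → GreedySeq _ _) :=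
    actEnd_top_pow_injective N
  have hi : ∀ r r' : R, (⟨D, memD⟩ : R) * r = (⟨D, memD⟩ : R) * r' → r = r' := by
    intro r r' e
    apply Subtype.ext
    funext L
    exact hinj (congrFun (congrArg Subtype.val e) L)
  obtain ⟨K, _, j, hj, hu⟩ := exists_injective_isUnit hc hi
  let f : Gen n → R := fun g => ⟨actEnd (atom g), mem _⟩
  have hunit : ∀ g, IsUnit (j (f g)) := by
    intro g
    have hb : (permLen (Fin (n + 1))).Below (cox n * (tr g)⁻¹) (cox n) := by
      have h1 := tr_below_cox g
      have h2 := len_conj (permLen (Fin (n + 1))) ((tr g)⁻¹ * cox n) (tr g)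
      rw [mul_inv_cancel_left] at h2
      unfold Below at *
      rw [show (cox n * (tr g)⁻¹)⁻¹ * cox n = tr g by group, h2, add_comm]
      exact h1
    let b : NC n := ⟨cox n * (tr g)⁻¹, hb⟩
    have hmul : IsMul b (atom g) ⊤ := ⟨le_top, (inv_mul_cancel_right (cox n) (tr g)).symm⟩
    -- Each generator divides $\top$ on both sides, hence divides $D=\top^{M+1}$ on both sides, and
    -- so becomes a unit in $K$.
    have e1 : f g * (⟨actEnd (atom g).compl, mem _⟩ * ⟨actEnd ⊤, mem _⟩ ^ M) = ⟨D, memD⟩ := by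
      apply Subtype.ext
      change actEnd (atom g) * (actEnd (atom g).compl * actEnd ⊤ ^ M) = D
      rw [← mul_assoc, actEnd_mul (isMul_compl _), hD, hM, pow_succ']
    have e2 : (⟨actEnd ⊤, mem _⟩ ^ M * ⟨actEnd b, mem _⟩) * f g = ⟨D, memD⟩ := by
      apply Subtype.ext
      change (actEnd ⊤ ^ M * actEnd b) * actEnd (atom g) = D
      rw [mul_assoc, actEnd_mul hmul, hD, hM, pow_succ]
    obtain ⟨u, e1⟩ : ∃ u, f g * u = ⟨D, memD⟩ := ⟨_, e1⟩
    obtain ⟨v, e2⟩ : ∃ v, v * f g = ⟨D, memD⟩ := ⟨_, e2⟩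
    refine isUnit_of_mul_isUnit (u := j u) (v := j v) ?_ ?_
    · rwa [← map_mul, e1]
    · rwa [← map_mul, e2]
  let F : Gen n → Kˣ := fun g => (hunit g).unit
  have hF : ∀ g, (F g : K) = j (f g) := fun g => rfl
  let Φ : Braid n →* Kˣ := PresentedGroup.toGroup (f := F) (by
    rintro _ (⟨x, y, h⟩ | ⟨x, y, z, h⟩ | ⟨x, y, z, h⟩)
    all_goals
      simp only [map_mul, map_inv, FreeGroup.lift_apply_of]
      refine mul_inv_eq_one.mpr (Units.ext ?_)
      rw [Units.val_mul, Units.val_mul, hF, hF]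
      try rw [hF]
      rw [← map_mul, ← map_mul]
      refine congrArg j (Subtype.ext ?_)
    · exact actEnd_atom_relator_comm h
    · exact actEnd_atom_relator_left h
    · exact actEnd_atom_relator_right h)
  have hΦ : ∀ w : List (Gen n), (Φ (word w) : K) = j (w.map f).prod := by
    intro w
    induction w with
    | nil => simp [word_nil]
    | cons g w ih =>
      rw [word_cons, map_mul, Units.val_mul, ih, List.map_cons, List.prod_cons, map_mul,
        show Φ (gen g) = F g from PresentedGroup.toGroup.of _, hF]
  -- Equality in the group gives equality of units in $K$; injectivity of $j$ brings it back to the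
  -- action itself.
  have key : (w.map f).prod = (w'.map f).prod := hj (by rw [← hΦ, ← hΦ, h])
  have hval : ∀ w : List (Gen n), ((w.map f).prod : R).1 = actWord w := by
    intro w
    rw [actWord, ← Submonoid.coe_subtype, map_list_prod, List.map_map]
    rfl
  rw [← hval, ← hval, key]

end WordAction

open LengthFn Simple

/-! ### The exponent sum -/

section Degree

variable {n : ℕ}

variable (n) in
/-- The exponent sum of a braid. -/
def deg : Braid n →* Multiplicative ℤ :=
  PresentedGroup.toGroup (f := fun _ => Multiplicative.ofAdd 1) (by
    rintro _ (⟨x, y, h⟩ | ⟨x, y, z, h⟩ | ⟨x, y, z, h⟩) <;> simp)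

theorem deg_gen (g : Gen n) : deg n (gen g) = Multiplicative.ofAdd 1 :=
  PresentedGroup.toGroup.of _

theorem deg_word (w : List (Gen n)) : deg n (word w) = Multiplicative.ofAdd (w.length : ℤ) := by
  induction w with
  | nil => rfl
  | cons g w ih =>
    rw [word_cons, map_mul, ih, deg_gen, ← ofAdd_add, List.length_cons]
    push_cast
    rw [add_comm]

theorem length_eq_of_word_eq {w w' : List (Gen n)} (h : word w = word w') :
    w.length = w'.length := by
  have := congrArg (deg n) h
  rw [deg_word, deg_word] at this
  exact_mod_cast Multiplicative.ofAdd.injective this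

theorem exists_desc_eq_word {t s : ℕ} (hs : 1 ≤ s) (hst : s ≤ t) (ht : t ≤ n) :
    ∃ w : List (Gen n), desc n t s = word w ∧ w.length = t - s := by
  induction t with
  | zero => omega
  | succ t ih =>
    rw [desc]
    by_cases h : s ≤ t
    · obtain ⟨w, hw, hl⟩ := ih h (by omega)
      have h' : 1 ≤ t ∧ t < t + 1 ∧ t + 1 ≤ n := by omega
      refine ⟨⟨(t + 1, t), h'⟩ :: w, ?_, ?_⟩
      · rw [if_pos h, a, dif_pos h', hw, word_cons]
      · rw [List.length_cons, hl]
        omega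
    · rw [if_neg h]
      exact ⟨[], rfl, by simp; omega⟩

end Degree

/-! ### Simple braids and left-greedy pairs -/

section SimpleBraids

variable {n : ℕ}

theorem Simple.exists_isReduced (s : NC n) : ∃ w, IsReduced s.1 w :=
  BandBraid.exists_isReduced _ s.1 rfl s.2

/-- A reduced word of a simple element. -/
noncomputable def redWord (s : NC n) : List (Gen n) := Classical.choose s.exists_isReduced

theorem isReduced_redWord (s : NC n) : IsReduced s.1 (redWord s) :=
  Classical.choose_spec s.exists_isReduced

/-- The braid of a simple element. -/
noncomputable def simpleBraid (s : NC n) : Braid n := word (redWord s)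

theorem simpleBraid_eq_word {s : NC n} {w : List (Gen n)} (h : IsReduced s.1 w) :
    simpleBraid s = word w :=
  word_eq_of_isReduced _ s.1 rfl s.2 _ _ (isReduced_redWord s) h

theorem permHom_simpleBraid (s : NC n) : permHom n (simpleBraid s) = s.1 :=
  (isReduced_redWord s).1

theorem simpleBraid_mem_pos (s : NC n) : simpleBraid s ∈ Pos n := word_mem_pos _

theorem length_redWord (s : NC n) :
    (redWord s).length = (permLen (Fin (n + 1))).len s.1 := (isReduced_redWord s).2.symm

theorem simpleBraid_bot : simpleBraid (⊥ : NC n) = 1 :=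
  simpleBraid_eq_word (w := []) ⟨map_one _, len_one _⟩

theorem simpleBraid_top (hn : 1 ≤ n) : simpleBraid (⊤ : NC n) = delta n := by
  obtain ⟨w, hw, hl⟩ := exists_desc_eq_word (n := n) le_rfl hn le_rfl
  rw [delta, hw]
  refine simpleBraid_eq_word ⟨by rw [← hw]; rfl, ?_⟩
  rw [hl]
  exact permLen_desc le_rfl hn le_rfl

theorem simpleBraid_mul {x y z : NC n} (h : IsMul x y z) :
    simpleBraid z = simpleBraid x * simpleBraid y := by
  refine (simpleBraid_eq_word (w := redWord x ++ redWord y) ?_).trans (word_append _ _)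
  refine ⟨?_, ?_⟩
  · rw [word_append, map_mul, h.2]
    exact congrArg₂ (· * ·) (permHom_simpleBraid x) (permHom_simpleBraid y)
  · rw [List.length_append, length_redWord, length_redWord]
    have h1 := h.1
    rw [le_def, Below, h.2, inv_mul_cancel_left] at h1
    rw [h.2, h1]

theorem simpleBraid_mem_Q (hn : 1 ≤ n) (s : NC n) : simpleBraid s ∈ Q n :=
  ⟨simpleBraid_mem_pos s, simpleBraid s.compl, simpleBraid_mem_pos _, by
    rw [← simpleBraid_top hn]
    exact simpleBraid_mul (isMul_compl s)⟩

/-- If $\delta$ is the product of positive words $w$ and $v$, exponent sums give total length $n-1$,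
the absolute length of the Coxeter element. Subadditivity leaves no slack, so $w$ is reduced and its
permutation lies below the Coxeter element. -/
theorem exists_simpleBraid_of_mem_Q (hn : 1 ≤ n) {A : Braid n} (h : A ∈ Q n) :
    ∃ s : NC n, A = simpleBraid s := by
  obtain ⟨hA, B, hB, e⟩ := h
  obtain ⟨w, rfl⟩ := exists_word_of_mem_pos hA
  obtain ⟨v, rfl⟩ := exists_word_of_mem_pos hB
  obtain ⟨d, hd, hl⟩ := exists_desc_eq_word (n := n) le_rfl hn le_rfl
  have e1 := e
  rw [delta, hd, ← word_append] at e1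
  have e2 := length_eq_of_word_eq e1
  rw [hl, List.length_append] at e2
  have e3 : cox n = permHom n (word w) * permHom n (word v) := by rw [cox, e, map_mul]
  have e4 : (permLen (Fin (n + 1))).len (cox n) = n - 1 := permLen_desc le_rfl hn le_rfl
  have l1 := permLen_permHom_word_le w
  have l2 := permLen_permHom_word_le v
  have l3 := len_mul_le (permLen (Fin (n + 1))) (permHom n (word w)) (permHom n (word v))
  rw [← e3] at l3
  have hb : (permLen (Fin (n + 1))).Below (permHom n (word w)) (cox n) := by
    apply below_of_le
    rw [e3, inv_mul_cancel_left, ← e3]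
    omega
  exact ⟨⟨_, hb⟩, (simpleBraid_eq_word ⟨rfl, by
    change (permLen _).len (permHom n (word w)) = _
    omega⟩).symm⟩

theorem act_bot (L : ℕ → NC n) : act ⊥ L = L := by
  have hc : (⊥ : NC n).compl = ⊤ := by
    apply Subtype.ext
    change (1 : Equiv.Perm (Fin (n + 1)))⁻¹ * cox n = cox n
    rw [inv_one, one_mul]
  have ht : ∀ i, carry ⊥ L i = ⊥ := by
    intro i
    induction i with
    | zero => rfl
    | succ i ih =>
      rw [carry, ih]
      apply Subtype.ext
      rw [tail_val, hc, top_inf_eq, inv_mul_cancel, bot_val]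
  funext i
  apply Subtype.ext
  rw [act, ht, head_val, hc, top_inf_eq, bot_val, one_mul]

theorem actWord_of_isReduced {w : List (Gen n)} :
    ∀ {s : NC n}, IsReduced s.1 w → actWord w = actEnd s := by
  induction w with
  | nil =>
    intro s h
    have hs : s = ⊥ := Subtype.ext (h.1.symm.trans (map_one _))
    subst hs
    exact funext fun L => Subtype.ext (act_bot L.1).symm
  | cons g w ih =>
    intro s h
    obtain ⟨hb, hr⟩ := h.of_cons
    have hq := hb.quotient_below
    rw [tr_inv] at hq
    let y : NC n := ⟨tr g * s.1, hq.trans s.2⟩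
    have hm : IsMul (atom g) y s := ⟨hb, (tr_mul_tr_mul g s.1).symm⟩
    rw [← actEnd_mul hm, ← ih (s := y) hr]
    rfl

/-- This turns a condition on all positive factorizations in the group into a meet. If the meet is
nontrivial, the head is a simple divisor longer than $x$. If it is trivial, the action detects the
maximal simple divisor. -/
theorem leftGreedy_iff (hn : 1 ≤ n) (x y : NC n) :
    LeftGreedy (simpleBraid x) (simpleBraid y) ↔ x.compl ⊓ y = ⊥ := by
  constructor
  · rintro ⟨-, -, H⟩
    set z := x.compl ⊓ y with hz
    have h1 : IsMul x z (head x y) := ⟨le_head x y, rfl⟩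
    have h2 : IsMul z (tail x y) y := isMul_quot _
    obtain ⟨P, hP, e⟩ := H (simpleBraid (head x y)) (simpleBraid_mem_Q hn _)
      (simpleBraid (tail x y)) (simpleBraid_mem_pos _)
      (by rw [simpleBraid_mul h1, simpleBraid_mul h2, mul_assoc])
    obtain ⟨w, rfl⟩ := exists_word_of_mem_pos hP
    rw [simpleBraid_mul h1, mul_assoc] at e
    have e1 : word (redWord z ++ w) = word ([] : List (Gen n)) := by
      rw [word_append]
      exact mul_eq_left.mp e.symm
    have e2 := length_eq_of_word_eq e1
    rw [List.length_append, length_redWord, List.length_nil] at e2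
    have e3 : (permLen (Fin (n + 1))).len z.1 = 0 := by omega
    exact Subtype.ext (eq_one_of_len _ e3)
  · intro h
    refine ⟨simpleBraid_mem_Q hn x, simpleBraid_mem_pos y, ?_⟩
    intro A' hA P hP e
    obtain ⟨z, rfl⟩ := exists_simpleBraid_of_mem_Q hn hA
    obtain ⟨w, rfl⟩ := exists_word_of_mem_pos hP
    have e1 : word (redWord x ++ redWord y) = word (redWord z ++ w) := by
      rw [word_append, word_append]
      exact e
    have e2 := actWord_eq_of_word_eq e1
    rw [actWord, actWord, List.map_append, List.map_append, List.prod_append,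
      List.prod_append] at e2
    change actWord _ * actWord _ = actWord _ * actWord _ at e2
    rw [actWord_of_isReduced (isReduced_redWord x), actWord_of_isReduced (isReduced_redWord y),
      actWord_of_isReduced (isReduced_redWord z)] at e2
    -- Act on the trivial sequence and compare first entries: the left side gives $x$, while the
    -- right side gives a head with carry $z$, hence an element above $z$.
    have hg : Greedy (fun _ => ⊥ : ℕ → NC n) := fun _ => inf_bot_eq _
    have e3 := congrArg Subtype.val (congrFun e2 ⟨_, hg⟩)
    change act x (act y fun _ => ⊥) = act z _ at e3
    have e4 := congrFun e3 0
    have hy : act y (fun _ => ⊥) 0 = y := head_eq_of_inf (inf_bot_eq _)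
    have hx : act x (act y fun _ => ⊥) 0 = x := by
      change head x (act y (fun _ => ⊥) 0) = x
      rw [hy]
      exact head_eq_of_inf h
    rw [hx] at e4
    have hle : z ≤ x := e4 ▸ le_head z _
    exact ⟨simpleBraid (z.quot x hle), simpleBraid_mem_pos _, simpleBraid_mul (isMul_quot hle)⟩

end SimpleBraids

/-! ### Uniqueness of the normal form -/

section NormalForms

variable {n : ℕ}

/-- The sequence of simple elements that starts with a list and is trivial afterwards. -/
noncomputable def listSeq : List (NC n) → ℕ → NC n
  | [] => fun _ => ⊥
  | s :: l => cons s (listSeq l)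

theorem greedy_listSeq {l : List (NC n)} (h : l.IsChain fun x y => x.compl ⊓ y = ⊥) :
    Greedy (listSeq l) := by
  induction l with
  | nil => exact fun _ => inf_bot_eq _
  | cons s l ih =>
    intro i
    cases i with
    | zero =>
      cases l with
      | nil => exact inf_bot_eq _
      | cons t l => exact (List.isChain_cons_cons.mp h).1
    | succ i => exact ih h.tail i

theorem act_listSeq {s : NC n} {l : List (NC n)}
    (h : (s :: l).IsChain fun x y => x.compl ⊓ y = ⊥) :
    act s (listSeq l) = listSeq (s :: l) := by
  refine act_eq_cons ?_ (greedy_listSeq h.tail)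
  cases l with
  | nil => exact inf_bot_eq _
  | cons t l => exact (List.isChain_cons_cons.mp h).1

theorem word_flatMap_redWord (l : List (NC n)) :
    word (l.flatMap redWord) = (l.map simpleBraid).prod := by
  induction l with
  | nil => rfl
  | cons s l ih =>
    rw [List.flatMap_cons, word_append, ih, List.map_cons, List.prod_cons]
    rfl

theorem actWord_flatMap_redWord {l : List (NC n)}
    (h : l.IsChain fun x y => x.compl ⊓ y = ⊥) :
    (actWord (l.flatMap redWord) ⟨listSeq [], greedy_listSeq .nil⟩).1 = listSeq l := by
  induction l with
  | nil => rfl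
  | cons s l ih =>
    rw [List.flatMap_cons, actWord, List.map_append, List.prod_append]
    change (actWord _ (actWord _ _)).1 = _
    rw [actWord_of_isReduced (isReduced_redWord s)]
    change act s (actWord _ _).1 = _
    rw [ih h.tail, act_listSeq h]

theorem listSeq_inj {l l' : List (NC n)} (hl : ⊥ ∉ l) (hl' : ⊥ ∉ l')
    (h : listSeq l = listSeq l') : l = l' := by
  induction l generalizing l' with
  | nil =>
    cases l' with
    | nil => rfl
    | cons t l' =>
      have : (⊥ : NC n) = t := congrFun h 0
      exact absurd List.mem_cons_self (this ▸ hl')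
  | cons s l ih =>
    cases l' with
    | nil =>
      have : s = (⊥ : NC n) := congrFun h 0
      exact absurd List.mem_cons_self (this ▸ hl)
    | cons t l' =>
      have h1 : s = t := congrFun h 0
      have h2 : listSeq l = listSeq l' := funext fun i => congrFun h (i + 1)
      rw [h1, ih (fun hm => hl (List.mem_cons_of_mem _ hm))
        (fun hm => hl' (List.mem_cons_of_mem _ hm)) h2]

theorem top_ne_bot (hn : 2 ≤ n) : (⊤ : NC n) ≠ ⊥ := by
  intro h
  have h1 : (permLen (Fin (n + 1))).len (cox n) = n - 1 :=
    permLen_desc le_rfl (by omega) le_rfl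
  have h2 : cox n = 1 := congrArg Subtype.val h
  rw [h2, len_one] at h1
  omega

theorem isChain_replicate_append {l : List (NC n)} (p : ℕ)
    (h : l.IsChain fun x y => x.compl ⊓ y = ⊥) :
    (List.replicate p (⊤ : NC n) ++ l).IsChain fun x y => x.compl ⊓ y = ⊥ := by
  induction p with
  | zero => exact h
  | succ p ih =>
    rw [List.replicate_succ, List.cons_append]
    refine List.isChain_cons.mpr ⟨fun y _ => ?_, ih⟩
    rw [Simple.compl_top, bot_inf_eq]

theorem IsNormalForm.exists_simple (hn : 1 ≤ n) {W : Braid n} {u : ℤ} {L : List (Braid n)}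
    (h : IsNormalForm W u L) : ∃ l : List (NC n), L = l.map simpleBraid ∧ ⊥ ∉ l ∧ ⊤ ∉ l ∧
      l.IsChain fun x y => x.compl ⊓ y = ⊥ := by
  obtain ⟨-, hQ, hc⟩ := h
  have hex : ∃ l : List (NC n), L = l.map simpleBraid := by
    clear hc
    induction L with
    | nil => exact ⟨[], rfl⟩
    | cons A L ih =>
      obtain ⟨l, rfl⟩ := ih fun B hB => hQ B (List.mem_cons_of_mem _ hB)
      obtain ⟨s, rfl⟩ := exists_simpleBraid_of_mem_Q hn (hQ A List.mem_cons_self).1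
      exact ⟨s :: l, rfl⟩
  obtain ⟨l, rfl⟩ := hex
  refine ⟨l, rfl, ?_, ?_, ?_⟩
  · intro hm
    exact (hQ _ (List.mem_map_of_mem hm)).2 (.inl simpleBraid_bot)
  · intro hm
    exact (hQ _ (List.mem_map_of_mem hm)).2 (.inr (simpleBraid_top hn))
  · rw [List.isChain_map] at hc
    exact hc.imp fun x y => (leftGreedy_iff hn x y).mp

/-- The normal form of a braid is unique. -/
theorem IsNormalForm.unique (hn : 2 ≤ n) {W : Braid n} {u u' : ℤ} {L L' : List (Braid n)}
    (h : IsNormalForm W u L) (h' : IsNormalForm W u' L') : u = u' ∧ L = L' := by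
  classical
  obtain ⟨l, rfl, b, t, c⟩ := h.exists_simple (by omega)
  obtain ⟨l', rfl, b', t', c'⟩ := h'.exists_simple (by omega)
  have e := h.1.symm.trans h'.1
  -- Multiplying by $\delta^N$ with $N=|u|+|u'|$ makes both exponents nonnegative, so that both
  -- sides become positive words.
  obtain ⟨N, p, p', hp, hp'⟩ : ∃ (N : ℤ) (p p' : ℕ), N + u = p ∧ N + u' = p' :=
    ⟨|u| + |u'|, (|u| + |u'| + u).toNat, (|u| + |u'| + u').toNat,
      by have := neg_abs_le u; have := abs_nonneg u'; omega,
      by have := neg_abs_le u'; have := abs_nonneg u; omega⟩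
  have e1 := congrArg (delta n ^ N * ·) e
  beta_reduce at e1
  rw [← mul_assoc, ← mul_assoc, ← zpow_add, ← zpow_add, hp, hp', zpow_natCast, zpow_natCast,
    ← simpleBraid_top (by omega)] at e1
  have rep : ∀ (p : ℕ) (l : List (NC n)), simpleBraid ⊤ ^ p * (l.map simpleBraid).prod =
      word ((List.replicate p ⊤ ++ l).flatMap redWord) := by
    intro p l
    rw [word_flatMap_redWord, List.map_append, List.prod_append, List.map_replicate,
      List.prod_replicate]
  rw [rep, rep] at e1
  have e2 := congrArg Subtype.val (congrFun (actWord_eq_of_word_eq e1)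
    ⟨listSeq [], greedy_listSeq .nil⟩)
  rw [actWord_flatMap_redWord (isChain_replicate_append p c),
    actWord_flatMap_redWord (isChain_replicate_append p' c')] at e2
  have nb : ∀ (p : ℕ) (l : List (NC n)), ⊥ ∉ l → ⊥ ∉ List.replicate p (⊤ : NC n) ++ l := by
    intro p l hl hm
    rcases List.mem_append.mp hm with hm | hm
    · exact top_ne_bot hn (List.eq_of_mem_replicate hm).symm
    · exact hl hm
  have e3 := listSeq_inj (nb p l b) (nb p' l' b') e2
  -- The factors of a normal form differ from $\top$, so the number of entries $\top$ recovers the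
  -- exponent of $\delta$.
  have e4 := congrArg (List.count ⊤) e3
  rw [List.count_append, List.count_append, List.count_replicate_self,
    List.count_replicate_self, List.count_eq_zero_of_not_mem t,
    List.count_eq_zero_of_not_mem t'] at e4
  simp only [add_zero] at e4
  subst e4
  exact ⟨by omega, by rw [List.append_cancel_left e3]⟩

theorem IsNormalForm.inf_eq (hn : 2 ≤ n) {W : Braid n} {u : ℤ} {L : List (Braid n)}
    (h : IsNormalForm W u L) : inf W = u := by
  obtain ⟨L', h'⟩ := Classical.epsilon_spec (p := fun u => ∃ L, IsNormalForm W u L) ⟨u, L, h⟩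
  exact (h'.unique hn h).1

theorem IsNormalForm.cycling_eq (hn : 2 ≤ n) {W : Braid n} {u : ℤ} {L : List (Braid n)}
    (h : IsNormalForm W u L) : cycling W = cycleForm u L := by
  obtain ⟨u', L', h', e⟩ := Classical.epsilon_spec
    (p := fun V => ∃ u L, IsNormalForm W u L ∧ V = cycleForm u L) ⟨_, u, L, h, rfl⟩
  obtain ⟨rfl, rfl⟩ := h'.unique hn h
  exact e

end NormalForms

open LengthFn Simple

/-! ### The braids $[m,\ldots,1][n,\ldots,m]$ and their cyclings -/

section Example

variable {n : ℕ}

theorem simpleBraid_atom (g : Gen n) : simpleBraid (atom g) = gen g := by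
  have h : IsReduced (tr g) [g] := by
    refine ⟨?_, ?_⟩
    · rw [word_cons, word_nil, mul_one, permHom_gen]
    · rw [permLen_tr, List.length_singleton]
  rw [simpleBraid_eq_word (s := atom g) h, word_cons, word_nil, mul_one]

theorem a_mul_a_eq {M t s : ℕ} (hs : 1 ≤ s) (hst : s < t) (ht : t < M) (hM : M ≤ n) :
    a n M t * a n t s = a n t s * a n M s := by
  rw [a, a, a, dif_pos (by omega), dif_pos (by omega), dif_pos (by omega)]
  have h : IsTriple (M, t) (t, s) (M, s) := ⟨rfl, rfl, rfl⟩
  exact (gen_tripleLeft ⟨(M, t), _⟩ ⟨(t, s), _⟩ ⟨(M, s), by omega⟩ h).trans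
    (gen_tripleRight ⟨(M, t), _⟩ ⟨(t, s), _⟩ ⟨(M, s), _⟩ h)

theorem a_comm {t s r q : ℕ} (hs : 1 ≤ s) (hst : s < t) (ht : t < q) (hq : q < r) (hr : r ≤ n) :
    Commute (a n t s) (a n r q) := by
  rw [a, a, dif_pos (by omega), dif_pos (by omega)]
  refine gen_comm _ _ ?_
  rw [unlinked_iff]
  exact .inl ht

theorem a_mem_pos (t s : ℕ) : a n t s ∈ Pos n := by
  rw [a]
  split_ifs
  · exact Submonoid.subset_closure ⟨_, rfl⟩
  · exact one_mem _

theorem desc_mem_pos (t s : ℕ) : desc n t s ∈ Pos n := by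
  induction t with
  | zero => exact one_mem _
  | succ t ih =>
    rw [desc]
    split_ifs
    · exact mul_mem (a_mem_pos _ _) ih
    · exact one_mem _

theorem desc_self (t : ℕ) : desc n t t = 1 := by
  cases t with
  | zero => rfl
  | succ t => rw [desc, if_neg (by omega)]

theorem desc_succ {t s : ℕ} (h : s ≤ t) : desc n (t + 1) s = a n (t + 1) t * desc n t s := by
  rw [desc, if_pos h]

theorem desc_succ_self (t : ℕ) : desc n (t + 1) t = a n (t + 1) t := by
  rw [desc_succ le_rfl, desc_self, mul_one]

theorem desc_mul_desc {t m s : ℕ} (hm : s ≤ m) (ht : m ≤ t) :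
    desc n t m * desc n m s = desc n t s := by
  induction t, ht using Nat.le_induction with
  | base => rw [desc_self, one_mul]
  | succ t ht ih => rw [desc_succ ht, desc_succ (hm.trans ht), mul_assoc, ih]

theorem a_mul_desc {M t s : ℕ} (hs : 1 ≤ s) (hst : s ≤ t) (ht : t < M) (hM : M ≤ n) :
    a n M t * desc n t s = desc n t s * a n M s := by
  induction t, hst using Nat.le_induction with
  | base => rw [desc_self, one_mul, mul_one]
  | succ t hst ih =>
    rw [desc_succ hst, ← mul_assoc, a_mul_a_eq (by omega) (by omega) ht hM, mul_assoc,
      ih (by omega), mul_assoc]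

theorem commute_a_desc {t s r q : ℕ} (hs : 1 ≤ s) (hst : s < t) (ht : t < q) (hr : r ≤ n) :
    Commute (a n t s) (desc n r q) := by
  induction r with
  | zero => exact Commute.one_right _
  | succ r ih =>
    rw [desc]
    split_ifs with h
    · exact (a_comm hs hst (by omega) (by omega) hr).mul_right (ih (by omega))
    · exact Commute.one_right _

theorem commute_desc {t s r q : ℕ} (hs : 1 ≤ s) (ht : t < q) (hr : r ≤ n) :
    Commute (desc n t s) (desc n r q) := by
  induction t with
  | zero => exact Commute.one_left _
  | succ t ih =>
    rw [desc]
    split_ifs with h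
    · exact (commute_a_desc (by omega) (by omega) ht hr).mul_left (ih (by omega))
    · exact Commute.one_left _

/-- Every product of two complementary descending products is a simple left divisor of `δ`. -/
theorem delta_eq_desc_mul {m : ℕ} (hm : 1 ≤ m) (hmn : m + 1 ≤ n) :
    delta n = desc n m 1 * desc n n (m + 1) * a n (m + 1) 1 := by
  rw [delta, ← desc_mul_desc (n := n) (s := 1) (m := m + 1) (by omega) hmn, desc_succ hm,
    a_mul_desc le_rfl hm (by omega) hmn,
    (commute_desc (n := n) le_rfl (by omega : m < m + 1) le_rfl).eq, mul_assoc]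

theorem deg_desc {t s : ℕ} (hs : 1 ≤ s) (hst : s ≤ t) (ht : t ≤ n) :
    deg n (desc n t s) = Multiplicative.ofAdd ((t : ℤ) - s) := by
  obtain ⟨w, hw, hl⟩ := exists_desc_eq_word hs hst ht
  rw [hw, deg_word, hl]
  congr 1
  omega

theorem mem_QStar_of_deg (hn : 1 ≤ n) {A : Braid n} (hA : A ∈ Q n) {d : ℤ}
    (hd : deg n A = Multiplicative.ofAdd d) (h0 : d ≠ 0) (h1 : d ≠ (n : ℤ) - 1) :
    A ∈ QStar n := by
  refine ⟨hA, ?_⟩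
  rintro (rfl | rfl)
  · rw [map_one] at hd
    exact h0 (Multiplicative.ofAdd.injective hd).symm
  · rw [delta, deg_desc le_rfl hn le_rfl] at hd
    exact h1 (by simpa using (Multiplicative.ofAdd.injective hd).symm)

/-- The first factor has exponent sum $n-2$ and the second is an atom. A nontrivial meet of that
atom with the complement of the first factor would equal the atom, and comparing lengths would make
the product map to the Coxeter element. The condition $2\le m$ excludes $m=1$, where the product is
$\delta$ itself. -/
theorem isNormalForm_desc_mul_desc {m : ℕ} (hm : 2 ≤ m) (hmn : m + 1 ≤ n) :
    IsNormalForm (desc n m 1 * desc n n m) 0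
      [desc n m 1 * desc n n (m + 1), desc n (m + 1) m] := by
  have hA : desc n m 1 * desc n n (m + 1) ∈ Q n :=
    ⟨mul_mem (desc_mem_pos _ _) (desc_mem_pos _ _), _, a_mem_pos _ _,
      delta_eq_desc_mul (by omega) hmn⟩
  have dA : deg n (desc n m 1 * desc n n (m + 1)) = Multiplicative.ofAdd ((n : ℤ) - 2) := by
    rw [map_mul, deg_desc le_rfl (by omega) (by omega), deg_desc (by omega) hmn le_rfl,
      ← ofAdd_add]
    congr 1
    push_cast
    ring
  have dB : deg n (desc n (m + 1) m) = Multiplicative.ofAdd 1 := by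
    rw [deg_desc (by omega) (by omega) hmn]
    congr 1
    push_cast
    ring
  let g : Gen n := ⟨(m + 1, m), by omega⟩
  have hg : desc n (m + 1) m = simpleBraid (atom g) := by
    rw [desc_succ_self, a, dif_pos (by omega)]
    exact (simpleBraid_atom g).symm
  have hB : desc n (m + 1) m ∈ Q n := hg ▸ simpleBraid_mem_Q (by omega) _
  have eW : desc n m 1 * desc n n m = desc n m 1 * desc n n (m + 1) * desc n (m + 1) m := by
    rw [mul_assoc, desc_mul_desc (by omega) hmn]
  refine ⟨?_, ?_, ?_⟩
  · rw [zpow_zero, one_mul, List.prod_cons, List.prod_singleton, eW]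
  · intro A hA'
    rcases List.mem_cons.mp hA' with rfl | hA'
    · exact mem_QStar_of_deg (by omega) hA dA (by omega) (by omega)
    · rw [List.mem_singleton.mp hA']
      exact mem_QStar_of_deg (by omega) hB dB (by omega) (by omega)
  · refine List.isChain_pair.mpr ?_
    obtain ⟨x, hx⟩ := exists_simpleBraid_of_mem_Q (by omega) hA
    rw [hx, hg, leftGreedy_iff (by omega)]
    have hlx : (permLen (Fin (n + 1))).len x.1 = n - 2 := by
      rw [hx, simpleBraid, deg_word, length_redWord] at dA
      have := Multiplicative.ofAdd.injective dA
      omega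
    set z := x.compl ⊓ atom g with hz
    by_contra hne
    have hz1 : (permLen (Fin (n + 1))).len z.1 ≠ 0 := fun h =>
      hne (Subtype.ext (eq_one_of_len _ h))
    have hzg : z = atom g := by
      refine Subtype.ext (Below.eq_of_len_le (N := permLen (Fin (n + 1)))
        (inf_le_right : x.compl ⊓ atom g ≤ atom g) ?_)
      change (permLen (Fin (n + 1))).len (tr g) ≤ _
      rw [permLen_tr]
      omega
    have hle : atom g ≤ x.compl := hzg ▸ inf_le_left
    have hmul := mul_below hle
    rw [show (atom g).1 = tr g from rfl] at hmul
    obtain ⟨h1, h2⟩ := hmul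
    have h3 : (permLen (Fin (n + 1))).len (cox n) = n - 1 :=
      permLen_desc le_rfl (by omega) le_rfl
    have h4 : x.1 * tr g = cox n := by
      refine Below.eq_of_len_le (N := permLen (Fin (n + 1))) h2 ?_
      unfold Below at h1
      rw [inv_mul_cancel_left, hlx, permLen_tr] at h1
      omega
    have h5 : permHom n (desc n m 1 * desc n n m) = cox n := by
      rw [eW, map_mul, hx, hg, permHom_simpleBraid, permHom_simpleBraid]
      exact h4
    -- The index $1$ separates the two permutations: the product sends it to $m$, the Coxeter
    -- element to $n>m$.
    have h6 := congrArg (fun w : Equiv.Perm (Fin (n + 1)) => (w ⟨1, by omega⟩ : ℕ)) h5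
    beta_reduce at h6
    have h7 : permHom n (desc n n m) ⟨1, by omega⟩ = ⟨1, by omega⟩ := by
      apply Fin.ext
      rw [permHom_desc_apply (by omega) (by omega) le_rfl]
      dsimp only
      split_ifs <;> omega
    rw [map_mul, Equiv.Perm.mul_apply, h7, permHom_desc_apply le_rfl (by omega) (by omega),
      cox_apply (by omega), if_pos rfl, if_pos rfl] at h6
    omega

/-- With exponent $0$ no twist occurs, and $[m+1,m]$ moved to the front merges with $[m,\ldots,1]$
into $[m+1,\ldots,1]$. -/
theorem cycling_desc_mul_desc {m : ℕ} (hm : 2 ≤ m) (hmn : m + 1 ≤ n) :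
    cycling (desc n m 1 * desc n n m) = desc n (m + 1) 1 * desc n n (m + 1) := by
  rw [(isNormalForm_desc_mul_desc hm hmn).cycling_eq (by omega), cycleForm]
  rw [neg_zero, zpow_zero, zpow_zero, one_mul, List.prod_singleton, MulAut.one_apply,
    ← mul_assoc, desc_mul_desc (by omega) (by omega)]

theorem isConj_desc_mul_desc {m : ℕ} (hm : 1 ≤ m) (hmn : m + 1 ≤ n) :
    IsConj (desc n m 1 * desc n n m) (desc n (m + 1) 1 * desc n n (m + 1)) := by
  rw [isConj_iff]
  refine ⟨desc n (m + 1) m, ?_⟩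
  rw [← desc_mul_desc (n := n) (t := n) (m := m + 1) (s := m) (by omega) hmn,
    ← desc_mul_desc (n := n) (t := m + 1) (m := m) (s := 1) (by omega) (by omega)]
  group

theorem cycling_iterate_desc (k : ℕ) (hk : k + 2 ≤ n) :
    cycling^[k] (desc n 2 1 * desc n n 2) = desc n (k + 2) 1 * desc n n (k + 2) := by
  induction k with
  | zero => rfl
  | succ k ih =>
    rw [Function.iterate_succ_apply', ih (by omega), cycling_desc_mul_desc (by omega) (by omega)]

theorem isConj_cycling_iterate_desc (k : ℕ) (hk : k + 2 ≤ n) :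
    IsConj (desc n 2 1 * desc n n 2) (desc n (k + 2) 1 * desc n n (k + 2)) := by
  induction k with
  | zero => exact IsConj.refl _
  | succ k ih => exact (ih (by omega)).trans (isConj_desc_mul_desc (by omega) (by omega))

theorem isNormalForm_delta : IsNormalForm (delta n) 1 [] :=
  ⟨by rw [zpow_one, List.prod_nil, mul_one], by simp, .nil⟩

end Example

end BandBraid

theorem mainTheorem4 (n : ℕ) (hn : 3 ≤ n) :
    (BandBraid.IsNormalForm (BandBraid.desc n 2 1 * BandBraid.desc n n 2) 0
      [BandBraid.desc n 2 1 * BandBraid.desc n n 3, BandBraid.desc n 3 2]) ∧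
    (∀ k ≤ n - 3,
      BandBraid.inf (BandBraid.cycling^[k] (BandBraid.desc n 2 1 * BandBraid.desc n n 2)) = 0) ∧
    BandBraid.inf
      (BandBraid.cycling^[n - 2] (BandBraid.desc n 2 1 * BandBraid.desc n n 2)) = 1 ∧
    (∀ m : ℕ,
      (∀ X : BandBraid.Braid n, (∃ V, IsConj X V ∧ BandBraid.inf X < BandBraid.inf V) →
        BandBraid.inf X < BandBraid.inf (BandBraid.cycling^[m] X)) →
      n - 2 ≤ m) := by
  have h0 : ∀ k ≤ n - 3, BandBraid.inf
      (BandBraid.cycling^[k] (BandBraid.desc n 2 1 * BandBraid.desc n n 2)) = 0 := by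
    intro k hk
    rw [BandBraid.cycling_iterate_desc k (by omega)]
    exact (BandBraid.isNormalForm_desc_mul_desc (by omega) (by omega)).inf_eq (by omega)
  have hend : BandBraid.desc n (n - 2 + 2) 1 * BandBraid.desc n n (n - 2 + 2) =
      BandBraid.delta n := by
    rw [show n - 2 + 2 = n by omega, BandBraid.desc_self, mul_one, BandBraid.delta]
  have hinf : BandBraid.inf (BandBraid.delta n) = 1 :=
    BandBraid.isNormalForm_delta.inf_eq (by omega)
  refine ⟨BandBraid.isNormalForm_desc_mul_desc le_rfl hn, h0, ?_, ?_⟩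
  · rw [BandBraid.cycling_iterate_desc _ (by omega), hend, hinf]
  · intro m hm
    by_contra hlt
    have hW := h0 0 (by omega)
    rw [Function.iterate_zero, id_eq] at hW
    -- The braid $\delta$ is a conjugate of infimum $1$, so $W$ is a legitimate test case. For $m\le
    -- n-3$ the cycled braid still has infimum $0$.
    have := hm _ ⟨BandBraid.delta n, hend ▸
      BandBraid.isConj_cycling_iterate_desc (n - 2) (by omega), by rw [hinf, hW]; norm_num⟩
    rw [hW, h0 m (by omega)] at this
    exact lt_irrefl _ this
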